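/- Let $0=r_0<r_1<r_2<\cdots$ be a strictly increasing sequence of real numbers with $\lim_{m\to\infty} r_m=\infty$ that satisfies the Müntz condition $\sum_{i\ge 1} 1/r_i=\infty$, let $0<a<1$, and write $\Lambda_m=(r_0,\dots,r_m)$ and $E(\Lambda_m)=\operatorname{span}(1,t^{r_1},\dots,t^{r_m})$. The Chebyshev–Bernstein basis of $E(\Lambda_m)$ over $[a,1]$ is the unique basis $(B_0^m,\dots,B_m^m)$ of $E(\Lambda_m)$ with $\sum_k B_k^m=1$ such that, for $k=0,\dots,m$, $B_k^m$ has $k$ zeros at $a$ and $m-k$ zeros at $1$, counted with multiplicity. For a function $Q$ with values in some $\mathbb R^d$ and with components in $E(\Lambda_m)$, its control points $\eta_i(Q,\Lambda_m,[a,1])$, $0\le i\le m$, are the unique points of $\mathbb R^d$ with $Q(t)=\sum_{i=0}^m B_i^m(t)\,\eta_i(Q,\Lambda_m,[a,1])$ on $[a,1]$. Let $P$ be a function with values in $\mathbb R^s$ and components in $E(\Lambda_n)$. Then the control points of $P$ (for every $m\ge n$) and of $t^{r_1}$ (for every $m\ge1$) exist and are unique, $\eta_i(t^{r_1},\Lambda_m,[a,1])\in[a^{r_1},1]$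 for all $m\ge 1$ and $0\le i\le m$, and $$\lim_{m\to\infty}\ \max_{0\le i\le m}\Big\|P\big(\eta_i(t^{r_1},\Lambda_m,[a,1])^{1/r_1}\big)-\eta_i(P,\Lambda_m,[a,1])\Big\|_\infty=0 ,$$ where $\|\cdot\|_\infty$ is the maximum norm on $\mathbb R^s$. -/

import Mathlib

open Filter Topology Set

/-- The Müntz space `E(Λ_n) = span (t ^ r 0, t ^ r 1, …, t ^ r n)` of real functions.
Only the values of its elements at points `t > 0` are ever used. -/
noncomputable def muntzSpace (r : ℕ → ℝ) (n : ℕ) : Submodule ℝ (ℝ → ℝ) :=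
  Submodule.span ℝ (Set.range fun (k : Fin (n + 1)) (t : ℝ) => t ^ r k)

/-- `f` has (at least) `k` zeros at `x`, counted with multiplicity. -/
def VanishesToOrder (f : ℝ → ℝ) (k : ℕ) (x : ℝ) : Prop :=
  ∀ j < k, iteratedDeriv j f x = 0

/-- `(B 0, …, B n)` is the Chebyshev-Bernstein basis of the Müntz space `E(Λ_n)` over `[a, b]`:
a basis of that space, normalized to have sum one, such that `B k` has `k` zeros at `a` and
`n - k` zeros at `b`. -/
structure IsChebyshevBernsteinBasis (r : ℕ → ℝ) (n : ℕ) (a b : ℝ)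
    (B : Fin (n + 1) → ℝ → ℝ) : Prop where
  linearIndependent : LinearIndependent ℝ B
  span_eq : Submodule.span ℝ (Set.range B) = muntzSpace r n
  sum_eq_one : ∀ t ∈ Set.Icc a b, ∑ k, B k t = 1
  zeros_left : ∀ k : Fin (n + 1), VanishesToOrder (B k) k a
  zeros_right : ∀ k : Fin (n + 1), VanishesToOrder (B k) (n - k) b

/-- `(p 0, …, p n)` are the Chebyshev-Bézier control points over `[a, b]` of the curve `P`,
viewed as an element of the Müntz space `E(Λ_n)`. -/
def IsControlPolygon {V : Type*} [AddCommGroup V] [Module ℝ V] (r : ℕ → ℝ) (n : ℕ) (a b : ℝ)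
    (P : ℝ → V) (p : Fin (n + 1) → V) : Prop :=
  ∃ B : Fin (n + 1) → ℝ → ℝ, IsChebyshevBernsteinBasis r n a b B ∧
    ∀ t ∈ Set.Icc a b, P t = ∑ k, B k t • p k

open Classical in
/-- The control points `η_i(P, Λ_n, [a, b])`, `i = 0, …, n`. -/
noncomputable def controlPoint {V : Type*} [AddCommGroup V] [Module ℝ V] (r : ℕ → ℝ) (n : ℕ)
    (a b : ℝ) (P : ℝ → V) : Fin (n + 1) → V :=
  if h : ∃ p : Fin (n + 1) → V, IsControlPolygon r n a b P p then h.choose else 0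

/-
Let `θ = t d/dt`, so that `p(θ) t ^ z = p(z) t ^ z`. For `i ≤ m` let `q / p` be the rational
function with `deg p ≤ i`, `deg q ≤ m - i` and `q(0) = 1` that interpolates `z ↦ a ^ z` at
`r 0, …, r m`. The functionals `f ↦ (p(θ) f)(a)` and `f ↦ (q(θ) f)(1)` agree on the Müntz space,
the first kills `B k` for `k > i` and the second for `k < i`; hence the `i`-th control point of
`t ^ r j` is `q(r j)`. Comparing consecutive interpolants shows that these values lie in
`[a ^ r j, 1]`, increase with `i`, and that those for `r j` are Lipschitz functions of those for
`r 1`, uniformly in `m`.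

By corner cutting, `q` is a convex combination of the polynomials `∏ (1 - X / r s)`, `k < s ≤ m`,
which by the Müntz condition are uniformly close to `exp(-σ z)` with `σ = ∑ 1 / r s` for large
`m`. A Müntz approximation of `t ^ (2 * r 1)` with small constants then bounds the variance
of the Bernstein weights `B k t` around `t ^ r 1`, and the Lipschitz estimate turns this into the
convergence of all control points.
-/

section ExpPolynomial

open Polynomial

theorem derivative_mem_degreeLT {p : ℝ[X]} {n : ℕ} (hp : p ∈ degreeLT ℝ (n + 1)) :
    derivative p ∈ degreeLT ℝ n := by
  rw [mem_degreeLT, degree_lt_iff_coeff_zero] at hp ⊢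
  intro m hm
  rw [coeff_derivative, hp (m + 1) (by omega), zero_mul]

theorem derivative_add_C_mul_mem_degreeLT {p : ℝ[X]} {n : ℕ} (hp : p ∈ degreeLT ℝ n) (c : ℝ) :
    derivative p + C c * p ∈ degreeLT ℝ n := by
  refine add_mem ?_ (C_mul' c p ▸ Submodule.smul_mem _ c hp)
  exact mem_degreeLT.2 ((degree_derivative_le).trans_lt (mem_degreeLT.1 hp))

theorem mem_degreeLT_of_coeff_eq_zero {p : ℝ[X]} {n : ℕ} (hp : p ∈ degreeLT ℝ (n + 1))
    (hn : p.coeff n = 0) : p ∈ degreeLT ℝ n := by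
  rw [mem_degreeLT, degree_lt_iff_coeff_zero] at hp ⊢
  intro m hm
  rcases hm.eq_or_lt with rfl | hm
  · exact hn
  · exact hp m hm

theorem eq_C_of_mem_degreeLT_one {p : ℝ[X]} (hp : p ∈ degreeLT ℝ 1) : p = C (p.coeff 0) :=
  eq_C_of_degree_le_zero (Nat.WithBot.lt_one_iff_le_zero.1 (mem_degreeLT.1 hp))

theorem coeff_eq_zero_of_mem_degreeLT {p : ℝ[X]} {n : ℕ} (hp : p ∈ degreeLT ℝ n) :
    p.coeff n = 0 :=
  coeff_eq_zero_of_degree_lt (mem_degreeLT.1 hp)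

theorem eq_zero_of_mem_degreeLT_of_eval_eq_zero {p : ℝ[X]} {n : ℕ} (hp : p ∈ degreeLT ℝ n)
    {Z : Finset ℝ} (hn : n ≤ Z.card) (hZ : ∀ z ∈ Z, p.eval z = 0) : p = 0 :=
  eq_zero_of_degree_lt_of_eval_finset_eq_zero Z
    ((mem_degreeLT.1 hp).trans_le (by exact_mod_cast hn)) hZ

theorem exists_finset_deriv_eq_zero {f f' : ℝ → ℝ} (hf : ∀ x, HasDerivAt f (f' x) x)
    {Z : Finset ℝ} (hZ : ∀ z ∈ Z, f z = 0) :
    ∃ Z' : Finset ℝ, Z.card ≤ Z'.card + 1 ∧ ∀ z ∈ Z', f' z = 0 ∧ ∃ w ∈ Z, w ≤ z := by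
  classical
  have rolle : ∀ w : ℝ × ℝ, ∃ c, w.1 ∈ Z → w.2 ∈ Z → w.1 < w.2 →
      w.1 < c ∧ c < w.2 ∧ f' c = 0 := by
    intro w
    by_cases h : w.1 ∈ Z ∧ w.2 ∈ Z ∧ w.1 < w.2
    · obtain ⟨c, hc, hc'⟩ := exists_hasDerivAt_eq_zero h.2.2
        (fun x _ => (hf x).continuousAt.continuousWithinAt)
        ((hZ _ h.1).trans (hZ _ h.2.1).symm) (fun x _ => hf x)
      exact ⟨c, fun _ _ _ => ⟨hc.1, hc.2, hc'⟩⟩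
    · exact ⟨0, fun h1 h2 h3 => (h ⟨h1, h2, h3⟩).elim⟩
  choose c hc using rolle
  refine ⟨((Z ×ˢ Z).filter fun w => w.1 < w.2).image c, ?_, ?_⟩
  · refine Finset.card_le_of_interleaved fun x hx y hy hxy _ => ?_
    exact ⟨c (x, y), Finset.mem_image_of_mem _ (by simp [hx, hy, hxy]),
      (hc (x, y) hx hy hxy).1, (hc (x, y) hx hy hxy).2.1⟩
  · intro z hz
    simp only [Finset.mem_image, Finset.mem_filter, Finset.mem_product] at hz
    obtain ⟨w, ⟨⟨h1, h2⟩, h3⟩, rfl⟩ := hz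
    exact ⟨(hc w h1 h2 h3).2.2, w.1, h1, (hc w h1 h2 h3).1.le⟩

theorem hasDerivAt_exp_const_mul (c x : ℝ) :
    HasDerivAt (fun z => Real.exp (c * z)) (Real.exp (c * x) * c) x := by
  simpa using ((hasDerivAt_id x).const_mul c).exp

theorem hasDerivAt_exp_mul_eval (c x : ℝ) (p : ℝ[X]) :
    HasDerivAt (fun z => Real.exp (c * z) * p.eval z)
      (Real.exp (c * x) * (derivative p + C c * p).eval x) x := by
  refine ((hasDerivAt_exp_const_mul c x).fun_mul (p.hasDerivAt x)).congr_deriv ?_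
  simp only [eval_add, eval_mul, eval_C]
  ring

theorem exists_exp_add_coeff_eq_zero (b : ℝ) (l : ℕ) : ∀ {A : ℝ} {q : ℝ[X]},
    q ∈ degreeLT ℝ (l + 1) → ∀ {Z : Finset ℝ},
    (∀ z ∈ Z, A * Real.exp (b * z) + q.eval z = 0) → l + 1 ≤ Z.card →
    ∃ z, A * b ^ l * Real.exp (b * z) + l.factorial * q.coeff l = 0 := by
  induction l with
  | zero =>
    intro A q hq Z hZ hcard
    obtain ⟨z, hz⟩ : Z.Nonempty := Finset.card_pos.1 (by omega)
    have hfz := hZ z hz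
    rw [eq_C_of_mem_degreeLT_one hq, eval_C] at hfz
    exact ⟨z, by simpa using hfz⟩
  | succ l ih =>
    intro A q hq Z hZ hcard
    obtain ⟨Z', hcard', hZ'⟩ := exists_finset_deriv_eq_zero
      (fun x => ((hasDerivAt_exp_const_mul b x).const_mul A).fun_add (q.hasDerivAt x)) hZ
    obtain ⟨z, hz⟩ := ih (A := A * b) (derivative_mem_degreeLT hq)
      (fun z hz => by linear_combination (hZ' z hz).1) (by omega)
    refine ⟨z, ?_⟩
    rw [coeff_derivative] at hz
    rw [Nat.factorial_succ]
    push_cast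
    linear_combination hz

theorem exists_exp_add_coeff_eq_zero_of_zeros (c d : ℝ) (l k : ℕ) : ∀ {A : ℝ} {p q : ℝ[X]},
    p ∈ degreeLT ℝ k → q ∈ degreeLT ℝ (l + 1) → ∀ {Z : Finset ℝ},
    (∀ z ∈ Z, A * Real.exp (d * z) + (p.eval z + Real.exp (c * z) * q.eval z) = 0) →
    k + l + 1 ≤ Z.card →
    ∃ z, A * d ^ k * (d - c) ^ l * Real.exp ((d - c) * z) +
      l.factorial * (c ^ k * q.coeff l) = 0 := by
  induction k with
  | zero =>
    intro A p q hp hq Z hZ hcard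
    have hp0 : p = 0 := by simpa [mem_degreeLT] using hp
    subst hp0
    simp only [pow_zero, mul_one, one_mul]
    refine exists_exp_add_coeff_eq_zero (d - c) l hq (fun z hz => ?_) (by omega : l + 1 ≤ Z.card)
    have hfz := hZ z hz
    rw [show d * z = c * z + (d - c) * z by ring, Real.exp_add, eval_zero] at hfz
    refine (mul_eq_zero.1 (?_ : Real.exp (c * z) * _ = 0)).resolve_left (Real.exp_ne_zero _)
    linear_combination hfz
  | succ k ih =>
    intro A p q hp hq Z hZ hcard
    obtain ⟨Z', hcard', hZ'⟩ := exists_finset_deriv_eq_zero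
      (fun x => ((hasDerivAt_exp_const_mul d x).const_mul A).fun_add
        ((p.hasDerivAt x).fun_add (hasDerivAt_exp_mul_eval c x q))) hZ
    obtain ⟨z, hz⟩ := ih (A := A * d) (derivative_mem_degreeLT hp)
      (derivative_add_C_mul_mem_degreeLT hq c)
      (fun z hz => by linear_combination (hZ' z hz).1) (by omega)
    refine ⟨z, ?_⟩
    rw [coeff_add, coeff_derivative, coeff_C_mul, coeff_eq_zero_of_mem_degreeLT hq] at hz
    linear_combination hz

theorem eq_zero_of_eval_add_exp_mul_eval_zeros {c : ℝ} (hc : c ≠ 0) {k l : ℕ} {p q : ℝ[X]}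
    (hp : p ∈ degreeLT ℝ k) (hq : q ∈ degreeLT ℝ l) {Z : Finset ℝ}
    (hZ : ∀ z ∈ Z, p.eval z + Real.exp (c * z) * q.eval z = 0) (hcard : k + l ≤ Z.card) :
    p = 0 ∧ q = 0 := by
  induction l with
  | zero =>
    have hq0 : q = 0 := by simpa [mem_degreeLT] using hq
    exact ⟨eq_zero_of_mem_degreeLT_of_eval_eq_zero hp hcard (by simpa [hq0] using hZ), hq0⟩
  | succ l ih =>
    obtain ⟨z, hz⟩ := exists_exp_add_coeff_eq_zero_of_zeros (A := 0) c 0 l k hp hq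
      (by simpa using hZ) hcard
    have hql : q.coeff l = 0 := by simpa [Nat.factorial_ne_zero, hc] using hz
    exact ih (mem_degreeLT_of_coeff_eq_zero hq hql) (by omega)

theorem eq_C_coeff_mul_nodal {q : ℝ[X]} {l : ℕ} (hq : q ∈ degreeLT ℝ (l + 1)) {Z : Finset ℝ}
    (hZ : ∀ z ∈ Z, q.eval z = 0) (hcard : Z.card = l) :
    q = C (q.coeff l) * Lagrange.nodal Z id := by
  have hdeg : (Lagrange.nodal Z (id : ℝ → ℝ)).natDegree = l := by
    rw [Lagrange.natDegree_nodal, hcard]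
  have hlead : (Lagrange.nodal Z (id : ℝ → ℝ)).coeff l = 1 :=
    hdeg ▸ (Lagrange.nodal_monic (s := Z) (v := id)).coeff_natDegree
  have hnodal : Lagrange.nodal Z (id : ℝ → ℝ) ∈ degreeLT ℝ (l + 1) :=
    mem_degreeLT.2 (degree_lt_iff_coeff_zero _ _ |>.2 fun m hm =>
      coeff_eq_zero_of_natDegree_lt (by omega))
  refine sub_eq_zero.1 (eq_zero_of_mem_degreeLT_of_eval_eq_zero (mem_degreeLT_of_coeff_eq_zero
    (sub_mem hq (C_mul' (q.coeff l) _ ▸ Submodule.smul_mem _ _ hnodal)) ?_) hcard.ge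
    fun z hz => ?_)
  · rw [coeff_sub, coeff_C_mul, hlead, mul_one, sub_self]
  · rw [eval_sub, eval_mul, hZ z hz, show (Lagrange.nodal Z id).eval z = 0 from
      Lagrange.eval_nodal_at_node (v := id) hz, mul_zero, sub_zero]

theorem tendsto_exp_mul_eval_atBot {c : ℝ} (hc : 0 < c) (q : ℝ[X]) :
    Tendsto (fun x => Real.exp (c * x) * q.eval x) atBot (𝓝 0) := by
  have hmap : Tendsto (fun x : ℝ => -(c * x)) atBot atTop :=
    tendsto_neg_atBot_atTop.comp (tendsto_id.const_mul_atBot hc)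
  refine ((tendsto_div_exp_atTop (q.comp (C (-c⁻¹) * X))).comp hmap).congr fun x => ?_
  simp only [Function.comp_apply, eval_comp, eval_mul, eval_C, eval_X, Real.exp_neg, div_inv_eq_mul]
  rw [show -c⁻¹ * -(c * x) = x by field_simp, mul_comm]

theorem eval_pos_of_derivative_add_C_mul_pos {c : ℝ} (hc : 0 < c) {q : ℝ[X]}
    (hq : ∀ x < 0, 0 < (derivative q + C c * q).eval x) {x : ℝ} (hx : x < 0) : 0 < q.eval x := by
  set g : ℝ → ℝ := fun x => Real.exp (c * x) * q.eval x
  have hmono : StrictMonoOn g (Iio 0) := by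
    refine strictMonoOn_of_deriv_pos (convex_Iio 0)
      (fun x _ => (hasDerivAt_exp_mul_eval c x q).continuousAt.continuousWithinAt) fun x hx => ?_
    rw [(hasDerivAt_exp_mul_eval c x q).deriv]
    exact mul_pos (Real.exp_pos _) (hq x (by simpa using hx))
  have hnonneg : 0 ≤ g (x - 1) := by
    refine le_of_tendsto (tendsto_exp_mul_eval_atBot hc q) ?_
    filter_upwards [eventually_le_atBot (x - 1)] with y hy
    exact hmono.monotoneOn (by simp only [mem_Iio]; linarith) (by simp only [mem_Iio]; linarith) hy
  have hgx : 0 < g x :=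
    hnonneg.trans_lt (hmono (by simp only [mem_Iio]; linarith) hx (sub_one_lt x))
  exact pos_of_mul_pos_right hgx (Real.exp_pos _).le

theorem coeff_mul_eval_pos_of_zeros {c : ℝ} (hc : 0 < c) (l k : ℕ) : ∀ {p q : ℝ[X]},
    p ∈ degreeLT ℝ k → q ∈ degreeLT ℝ (l + 1) → q.coeff l ≠ 0 → ∀ {Z : Finset ℝ},
    (∀ z ∈ Z, 0 ≤ z) → (∀ z ∈ Z, p.eval z + Real.exp (c * z) * q.eval z = 0) →
    k + l ≤ Z.card → ∀ x < 0, 0 < (-1) ^ l * q.coeff l * q.eval x := by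
  induction k with
  | zero =>
    intro p q hp hq hql Z hpos hZ hcard x hx
    have hp0 : p = 0 := by simpa [mem_degreeLT] using hp
    obtain ⟨Z', hsub, hcard'⟩ := Finset.exists_subset_card_eq ((zero_add l).ge.trans hcard)
    have hq_eq := eq_C_coeff_mul_nodal hq
      (fun z hz => by simpa [hp0, Real.exp_ne_zero] using hZ z (hsub hz)) hcard'
    have hprod : 0 < (-1) ^ l * (Lagrange.nodal Z' id).eval x := by
      rw [Lagrange.eval_nodal, ← hcard', ← Finset.prod_const, ← Finset.prod_mul_distrib]
      exact Finset.prod_pos fun z hz => by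
        have := hpos z (hsub hz)
        simp only [id_eq]
        linarith
    rw [hq_eq, eval_mul, eval_C, ← hq_eq]
    have := mul_pos (mul_self_pos.2 hql) hprod
    linarith
  | succ k ih =>
    intro p q hp hq hql Z hpos hZ hcard x hx
    obtain ⟨Z', hcard', hZ'⟩ := exists_finset_deriv_eq_zero
      (fun x => (p.hasDerivAt x).fun_add (hasDerivAt_exp_mul_eval c x q)) hZ
    have hlead : (derivative q + C c * q).coeff l = c * q.coeff l := by
      rw [coeff_add, coeff_derivative, coeff_C_mul, coeff_eq_zero_of_mem_degreeLT hq]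
      ring
    have hderiv := ih (derivative_mem_degreeLT hp) (derivative_add_C_mul_mem_degreeLT hq c)
      (hlead ▸ mul_ne_zero hc.ne' hql)
      (fun z hz => let ⟨w, hw, hwz⟩ := (hZ' z hz).2; (hpos w hw).trans hwz)
      (fun z hz => (hZ' z hz).1) (by omega)
    have hpos : ∀ y < 0, 0 < (derivative (C ((-1) ^ l * q.coeff l) * q) +
        C c * (C ((-1) ^ l * q.coeff l) * q)).eval y := by
      intro y hy
      refine pos_of_mul_pos_right (a := c) ?_ hc.le
      refine (hderiv y hy).trans_eq ?_
      rw [hlead, derivative_C_mul]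
      simp only [eval_add, eval_mul, eval_C]
      ring
    simpa only [eval_mul, eval_C] using eval_pos_of_derivative_add_C_mul_pos hc hpos hx

theorem eq_zero_of_rpow_mul_eval_eq_eval {a : ℝ} (ha : a ∈ Ioo 0 1) {ν : ℕ → ℝ}
    (hν : Function.Injective ν) {k l : ℕ} {p q : ℝ[X]} (hp : p ∈ degreeLT ℝ k)
    (hq : q ∈ degreeLT ℝ l) (h : ∀ j < k + l, a ^ ν j * p.eval (ν j) = q.eval (ν j)) :
    p = 0 ∧ q = 0 := by
  obtain ⟨hq0, hp0⟩ := eq_zero_of_eval_add_exp_mul_eval_zeros (Real.log_neg ha.1 ha.2).ne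
    (neg_mem hq) hp (Z := (Finset.range (k + l)).map ⟨ν, hν⟩) (by
      simp only [Finset.forall_mem_map, Finset.mem_range, Function.Embedding.coeFn_mk]
      intro j hj
      rw [← Real.rpow_def_of_pos ha.1, h j hj, eval_neg, neg_add_cancel])
    (by rw [Finset.card_map, Finset.card_range, add_comm])
  exact ⟨hp0, neg_eq_zero.1 hq0⟩

theorem coeff_sign_of_interpolates_rpow {a x : ℝ} (ha : 0 < a) (hx : x ∈ Ioo a 1) {ν : ℕ → ℝ}
    (hν : Function.Injective ν) {k l : ℕ} {p q : ℝ[X]} (hp : p ∈ degreeLT ℝ k)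
    (hq : q ∈ degreeLT ℝ (l + 1))
    (h : ∀ j < k + l + 1, a ^ ν j * p.eval (ν j) + q.eval (ν j) = x ^ ν j) :
    0 < (-1) ^ l * q.coeff l := by
  have hx0 : 0 < x := ha.trans hx.1
  have hlogx : Real.log x < 0 := Real.log_neg hx0 hx.2
  have hloga : 0 < Real.log x - Real.log a := sub_pos.2 (Real.log_lt_log ha hx.1)
  obtain ⟨z, hz⟩ := exists_exp_add_coeff_eq_zero_of_zeros (A := -1) (-Real.log a)
    (Real.log x - Real.log a) l k hp hq (Z := (Finset.range (k + l + 1)).map ⟨ν, hν⟩) (by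
      simp only [Finset.forall_mem_map, Finset.mem_range, Function.Embedding.coeFn_mk]
      intro j hj
      have hfz := h j hj
      rw [Real.rpow_def_of_pos ha, Real.rpow_def_of_pos hx0] at hfz
      have hexp : Real.exp (-Real.log a * ν j) * Real.exp (Real.log a * ν j) = 1 := by
        rw [← Real.exp_add, neg_mul, neg_add_cancel, Real.exp_zero]
      rw [show (Real.log x - Real.log a) * ν j = -Real.log a * ν j + Real.log x * ν j by ring,
        Real.exp_add]
      linear_combination Real.exp (-Real.log a * ν j) * hfz - p.eval (ν j) * hexp)
    (by rw [Finset.card_map, Finset.card_range])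
  rw [sub_neg_eq_add, sub_add_cancel] at hz
  have hpos : 0 < (Real.log x - Real.log a) ^ k * (-Real.log x) ^ l *
      Real.exp (Real.log x * z) :=
    mul_pos (mul_pos (pow_pos hloga k) (pow_pos (neg_pos.2 hlogx) l)) (Real.exp_pos _)
  have hcoeff : 0 < (l.factorial * (-Real.log a) ^ k : ℝ) :=
    mul_pos (by positivity) (pow_pos (by linarith) k)
  refine pos_of_mul_pos_right (a := (l.factorial * (-Real.log a) ^ k : ℝ)) ?_ hcoeff.le
  refine hpos.trans_eq ?_
  rw [neg_pow (Real.log x)]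
  linear_combination -(-1) ^ l * hz

end ExpPolynomial

section Interpolation

open Polynomial

/-- The linear map sending `(p, q)` to the values of `a ^ z p(z) + q(z)` at the first `n` nodes. Its
injectivity for `n = k + l` makes interpolation by such functions possible. -/
noncomputable def rpowInterpolation (a : ℝ) (ν : ℕ → ℝ) (k l n : ℕ) :
    (degreeLT ℝ k × degreeLT ℝ l) →ₗ[ℝ] (Fin n → ℝ) where
  toFun w j := a ^ ν j * (w.1 : ℝ[X]).eval (ν j) + (w.2 : ℝ[X]).eval (ν j)
  map_add' w w' := by
    funext j
    simp only [Prod.fst_add, Prod.snd_add, Submodule.coe_add, eval_add, Pi.add_apply]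
    ring
  map_smul' c w := by
    funext j
    simp only [Prod.smul_fst, Prod.smul_snd, Submodule.coe_smul, eval_smul, Pi.smul_apply,
      smul_eq_mul, RingHom.id_apply]
    ring

theorem finrank_degreeLT_prod (k l : ℕ) :
    Module.finrank ℝ (degreeLT ℝ k × degreeLT ℝ l) = k + l := by
  rw [Module.finrank_prod, (degreeLTEquiv ℝ k).finrank_eq, (degreeLTEquiv ℝ l).finrank_eq,
    Module.finrank_fin_fun, Module.finrank_fin_fun]

theorem exists_rpow_mul_eval_add_eval_eq {a : ℝ} (ha : a ∈ Ioo 0 1) {ν : ℕ → ℝ}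
    (hν : Function.Injective ν) (k l : ℕ) (v : ℕ → ℝ) :
    ∃ p ∈ degreeLT ℝ k, ∃ q ∈ degreeLT ℝ l,
      ∀ j < k + l, a ^ ν j * p.eval (ν j) + q.eval (ν j) = v j := by
  have hinj : Function.Injective (rpowInterpolation a ν k l (k + l)) := by
    refine (injective_iff_map_eq_zero _).2 fun w hw => ?_
    have hzero := eq_zero_of_rpow_mul_eval_eq_eval ha hν w.1.2 (neg_mem w.2.2) fun j hj => by
      rw [eval_neg, eq_neg_iff_add_eq_zero]
      exact congrFun hw ⟨j, hj⟩
    exact Prod.ext (Subtype.ext hzero.1) (Subtype.ext (neg_eq_zero.1 hzero.2))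
  obtain ⟨w, hw⟩ := (LinearMap.injective_iff_surjective_of_finrank_eq_finrank
    (by rw [finrank_degreeLT_prod, Module.finrank_fin_fun])).1 hinj fun j : Fin (k + l) => v j
  exact ⟨w.1, w.1.2, w.2, w.2.2, fun j hj => congrFun hw ⟨j, hj⟩⟩

theorem exists_eq_X_sub_C_mul {p : ℝ[X]} {n : ℕ} {c : ℝ} (hp : p ∈ degreeLT ℝ (n + 1))
    (hc : p.eval c = 0) : ∃ g ∈ degreeLT ℝ n, p = (X - C c) * g := by
  obtain ⟨g, rfl⟩ := dvd_iff_isRoot.2 hc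
  refine ⟨g, ?_, rfl⟩
  rcases eq_or_ne g 0 with rfl | hg
  · exact zero_mem _
  · rw [mem_degreeLT, degree_mul, degree_X_sub_C, degree_eq_natDegree hg] at hp
    rw [mem_degreeLT, degree_eq_natDegree hg]
    norm_cast at hp ⊢
    omega

theorem exists_common_factor_X_sub_C {a c : ℝ} (ha : 0 < a) {k l : ℕ} {p q : ℝ[X]}
    (hp : p ∈ degreeLT ℝ (k + 1)) (hq : q ∈ degreeLT ℝ (l + 1))
    (hc : a ^ c * p.eval c = q.eval c) (hqc : q.eval c = 0) :
    ∃ f ∈ degreeLT ℝ k, ∃ g ∈ degreeLT ℝ l, p = (X - C c) * f ∧ q = (X - C c) * g ∧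
      ∀ z ≠ c, a ^ z * p.eval z = q.eval z → a ^ z * f.eval z = g.eval z := by
  have hpc : p.eval c = 0 :=
    (mul_eq_zero.1 (hc.trans hqc)).resolve_left (Real.rpow_pos_of_pos ha c).ne'
  obtain ⟨f, hf, rfl⟩ := exists_eq_X_sub_C_mul hp hpc
  obtain ⟨g, hg, rfl⟩ := exists_eq_X_sub_C_mul hq hqc
  refine ⟨f, hf, g, hg, rfl, rfl, fun z hz h => mul_left_cancel₀ (sub_ne_zero.2 hz) ?_⟩
  simp only [eval_mul, eval_sub, eval_X, eval_C] at h
  linear_combination h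

end Interpolation

/-- The exponents `0 = ρ 0 < ρ 1 < ⋯` of a sequence of Müntz spaces. -/
structure IsExponentSeq (ρ : ℕ → ℝ) : Prop where
  zero : ρ 0 = 0
  strictMono : StrictMono ρ

namespace IsExponentSeq

variable {ρ : ℕ → ℝ}

theorem pos (hρ : IsExponentSeq ρ) {j : ℕ} (hj : 0 < j) : 0 < ρ j :=
  hρ.zero ▸ hρ.strictMono hj

theorem nonneg (hρ : IsExponentSeq ρ) (j : ℕ) : 0 ≤ ρ j :=
  hρ.zero ▸ hρ.strictMono.monotone j.zero_le

theorem shift (hρ : StrictMono ρ) : IsExponentSeq fun j => ρ (j + 1) - ρ 1 where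
  zero := sub_self _
  strictMono := fun _ _ hij => sub_lt_sub_right (hρ (Nat.succ_lt_succ hij)) _

end IsExponentSeq

section Pade

open Polynomial

variable {a : ℝ} {ρ : ℕ → ℝ} {k l : ℕ}

/-- The solutions `(p, q)` of the linearized problem of interpolating `a ^ z` at the `k + l + 1`
nodes `ρ 0, …, ρ (k + l)` by a rational function `q / p` of type `(l, k)`. -/
noncomputable def padeSpace (a : ℝ) (ρ : ℕ → ℝ) (k l : ℕ) : Submodule ℝ (ℝ[X] × ℝ[X]) where
  carrier := {w | w.1 ∈ degreeLT ℝ (k + 1) ∧ w.2 ∈ degreeLT ℝ (l + 1) ∧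
    ∀ j ≤ k + l, a ^ ρ j * w.1.eval (ρ j) = w.2.eval (ρ j)}
  add_mem' h h' := ⟨add_mem h.1 h'.1, add_mem h.2.1 h'.2.1, fun j hj => by
    simp only [Prod.fst_add, Prod.snd_add, eval_add, mul_add, h.2.2 j hj, h'.2.2 j hj]⟩
  zero_mem' := ⟨zero_mem _, zero_mem _, by simp⟩
  smul_mem' c w h := ⟨Submodule.smul_mem _ c h.1, Submodule.smul_mem _ c h.2.1, fun j hj => by
    simp only [Prod.smul_fst, Prod.smul_snd, eval_smul, smul_eq_mul, ← h.2.2 j hj]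
    ring⟩

/-- The Newton–Padé pair: the element `(p, q)` of `padeSpace a ρ k l` with `q(0) = 1`. -/
noncomputable def padePair (a : ℝ) (ρ : ℕ → ℝ) (k l : ℕ) : ℝ[X] × ℝ[X] :=
  Classical.epsilon fun w => w ∈ padeSpace a ρ k l ∧ w.2.eval 0 = 1

/-- The numerator of the Newton–Padé interpolant of `a ^ z`, of degree at most `l`. Its value at
`ρ j` turns out to be the control point `η_k(t ^ ρ j, Λ_{k+l}, [a, 1])`. -/
noncomputable def padeNum (a : ℝ) (ρ : ℕ → ℝ) (k l : ℕ) : ℝ[X] :=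
  (padePair a ρ k l).2

/-- The denominator of the Newton–Padé interpolant of `a ^ z`, of degree at most `k`. -/
noncomputable def padeDen (a : ℝ) (ρ : ℕ → ℝ) (k l : ℕ) : ℝ[X] :=
  (padePair a ρ k l).1

theorem eq_zero_of_mem_padeSpace (ha : a ∈ Ioo 0 1) (hρ : IsExponentSeq ρ) {w : ℝ[X] × ℝ[X]}
    (hw : w ∈ padeSpace a ρ k l) (hw0 : w.2.eval 0 = 0) : w = 0 := by
  obtain ⟨f, hf, g, hg, hp, hq, hfg⟩ := exists_common_factor_X_sub_C ha.1 hw.1 hw.2.1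
    (hρ.zero ▸ hw.2.2 0 (Nat.zero_le _)) hw0
  obtain ⟨rfl, rfl⟩ := eq_zero_of_rpow_mul_eval_eq_eval ha
    (hρ.strictMono.injective.comp (add_left_injective 1)) hf hg
    fun j hj => hfg _ (hρ.pos j.succ_pos).ne' (hw.2.2 (j + 1) hj)
  exact Prod.ext (by rw [hp, mul_zero]; rfl) (by rw [hq, mul_zero]; rfl)

theorem exists_mem_padeSpace_eval_zero_eq_one (ha : a ∈ Ioo 0 1) (hρ : IsExponentSeq ρ)
    (k l : ℕ) : ∃ w, w ∈ padeSpace a ρ k l ∧ w.2.eval 0 = 1 := by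
  have hker : LinearMap.ker (rpowInterpolation a ρ (k + 1) (l + 1) (k + l + 1)) ≠ ⊥ := by
    refine LinearMap.ker_ne_bot_of_finrank_lt ?_
    rw [finrank_degreeLT_prod, Module.finrank_fin_fun]
    omega
  obtain ⟨v, hv, hne⟩ := (Submodule.ne_bot_iff _).1 hker
  have hw : ((v.1 : ℝ[X]), -(v.2 : ℝ[X])) ∈ padeSpace a ρ k l :=
    ⟨v.1.2, neg_mem v.2.2, fun j hj => by
      rw [eval_neg, eq_neg_iff_add_eq_zero]
      exact congrFun (LinearMap.mem_ker.1 hv) ⟨j, by omega⟩⟩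
  have hw0 : (-(v.2 : ℝ[X])).eval 0 ≠ 0 := fun h0 => hne <| by
    have hzero := Prod.ext_iff.1 (eq_zero_of_mem_padeSpace ha hρ hw h0)
    exact Prod.ext (Subtype.ext hzero.1) (Subtype.ext (neg_eq_zero.1 hzero.2))
  exact ⟨_, Submodule.smul_mem _ ((-(v.2 : ℝ[X])).eval 0)⁻¹ hw, by
    rw [Prod.smul_snd, eval_smul, smul_eq_mul, inv_mul_cancel₀ hw0]⟩

theorem padePair_mem (ha : a ∈ Ioo 0 1) (hρ : IsExponentSeq ρ) (k l : ℕ) :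
    padePair a ρ k l ∈ padeSpace a ρ k l :=
  (Classical.epsilon_spec (exists_mem_padeSpace_eval_zero_eq_one ha hρ k l)).1

theorem padeNum_eval_zero (ha : a ∈ Ioo 0 1) (hρ : IsExponentSeq ρ) (k l : ℕ) :
    (padeNum a ρ k l).eval 0 = 1 :=
  (Classical.epsilon_spec (exists_mem_padeSpace_eval_zero_eq_one ha hρ k l)).2

theorem padeNum_ne_zero (ha : a ∈ Ioo 0 1) (hρ : IsExponentSeq ρ) (k l : ℕ) :
    padeNum a ρ k l ≠ 0 := fun h => by
  have h0 := padeNum_eval_zero ha hρ k l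
  rw [h, eval_zero] at h0
  exact zero_ne_one h0

theorem padeDen_mem_degreeLT (ha : a ∈ Ioo 0 1) (hρ : IsExponentSeq ρ) (k l : ℕ) :
    padeDen a ρ k l ∈ degreeLT ℝ (k + 1) :=
  (padePair_mem ha hρ k l).1

theorem padeNum_mem_degreeLT (ha : a ∈ Ioo 0 1) (hρ : IsExponentSeq ρ) (k l : ℕ) :
    padeNum a ρ k l ∈ degreeLT ℝ (l + 1) :=
  (padePair_mem ha hρ k l).2.1

theorem rpow_mul_padeDen_eval (ha : a ∈ Ioo 0 1) (hρ : IsExponentSeq ρ) {j : ℕ}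
    (hj : j ≤ k + l) : a ^ ρ j * (padeDen a ρ k l).eval (ρ j) = (padeNum a ρ k l).eval (ρ j) :=
  (padePair_mem ha hρ k l).2.2 j hj

theorem eq_C_mul_padeNum (ha : a ∈ Ioo 0 1) (hρ : IsExponentSeq ρ) {p q : ℝ[X]}
    (hp : p ∈ degreeLT ℝ (k + 1)) (hq : q ∈ degreeLT ℝ (l + 1))
    (h : ∀ j ≤ k + l, a ^ ρ j * p.eval (ρ j) = q.eval (ρ j)) :
    q = C (q.eval 0) * padeNum a ρ k l := by
  have hw : (p, q) - q.eval 0 • padePair a ρ k l ∈ padeSpace a ρ k l :=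
    sub_mem ⟨hp, hq, h⟩ (Submodule.smul_mem _ _ (padePair_mem ha hρ k l))
  have hzero := Prod.ext_iff.1 <| eq_zero_of_mem_padeSpace ha hρ hw (by
    change (q - q.eval 0 • padeNum a ρ k l).eval 0 = 0
    rw [eval_sub, eval_smul, padeNum_eval_zero ha hρ, smul_eq_mul, mul_one, sub_self])
  exact (sub_eq_zero.1 hzero.2).trans (C_mul' _ _).symm

theorem coeff_padeDen_ne_zero (ha : a ∈ Ioo 0 1) (hρ : IsExponentSeq ρ) (k l : ℕ) :
    (padeDen a ρ k l).coeff k ≠ 0 := fun hk =>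
  padeNum_ne_zero ha hρ k l (eq_zero_of_rpow_mul_eval_eq_eval ha hρ.strictMono.injective
    (mem_degreeLT_of_coeff_eq_zero (padeDen_mem_degreeLT ha hρ k l) hk)
    (padeNum_mem_degreeLT ha hρ k l)
    fun j hj => rpow_mul_padeDen_eval ha hρ (by omega)).2

theorem padeNum_coeff_sign (ha : a ∈ Ioo 0 1) (hρ : IsExponentSeq ρ) (k l : ℕ) :
    0 < (-1) ^ l * (padeNum a ρ k l).coeff l := by
  have hne : (padeNum a ρ k l).coeff l ≠ 0 := fun hl =>
    padeNum_ne_zero ha hρ k l (eq_zero_of_rpow_mul_eval_eq_eval ha hρ.strictMono.injective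
      (padeDen_mem_degreeLT ha hρ k l)
      (mem_degreeLT_of_coeff_eq_zero (padeNum_mem_degreeLT ha hρ k l) hl)
      fun j hj => rpow_mul_padeDen_eval ha hρ (by omega)).2
  have hneg := coeff_mul_eval_pos_of_zeros (neg_pos.2 (Real.log_neg ha.1 ha.2)) l (k + 1)
    (neg_mem (padeDen_mem_degreeLT ha hρ k l)) (padeNum_mem_degreeLT ha hρ k l) hne
    (Z := (Finset.range (k + l + 1)).map ⟨ρ, hρ.strictMono.injective⟩)
    (by simpa using fun j _ => hρ.nonneg j)
    (by
      simp only [Finset.forall_mem_map, Finset.mem_range, Function.Embedding.coeFn_mk]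
      intro j hj
      rw [← rpow_mul_padeDen_eval ha hρ (by omega), Real.rpow_def_of_pos ha.1, neg_mul,
        ← mul_assoc, ← Real.exp_add, neg_add_cancel, Real.exp_zero, eval_neg]
      ring)
    (by rw [Finset.card_map, Finset.card_range]; omega)
  have hlim : Tendsto (fun x => (-1) ^ l * (padeNum a ρ k l).coeff l * (padeNum a ρ k l).eval x)
      (𝓝[<] 0) (𝓝 ((-1) ^ l * (padeNum a ρ k l).coeff l * (padeNum a ρ k l).eval 0)) :=
    ((padeNum a ρ k l).continuous.continuousAt.tendsto.const_mul _).mono_left nhdsWithin_le_nhds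
  rw [padeNum_eval_zero ha hρ, mul_one] at hlim
  refine lt_of_le_of_ne' (ge_of_tendsto hlim ?_) (mul_ne_zero (by simp) hne)
  exact eventually_nhdsWithin_of_forall fun x hx => (hneg x hx).le

theorem coeff_taylor_of_mem_degreeLT {q : ℝ[X]} (hq : q ∈ degreeLT ℝ (l + 1)) (c : ℝ) :
    (taylor c q).coeff l = q.coeff l := by
  by_cases hl : q.coeff l = 0
  · rw [hl, coeff_eq_zero_of_mem_degreeLT
      (taylor_mem_degreeLT.2 (mem_degreeLT_of_coeff_eq_zero hq hl))]
  · have hdeg : q.natDegree = l := natDegree_eq_of_le_of_coeff_ne_zero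
      (Nat.lt_succ_iff.1 (natDegree_lt_iff_degree_lt (by rintro rfl; exact hl (coeff_zero l)) |>.2
        (mem_degreeLT.1 hq))) hl
    have htaylor := coeff_taylor_natDegree (r := c) (f := q)
    rwa [leadingCoeff, hdeg] at htaylor

-- Translating the nodes by `ρ 1` multiplies `a ^ z` by a constant only.
theorem eq_C_mul_taylor_padeNum (ha : a ∈ Ioo 0 1) (hρ : StrictMono ρ) {f g : ℝ[X]}
    (hf : f ∈ degreeLT ℝ (k + 1)) (hg : g ∈ degreeLT ℝ (l + 1))
    (h : ∀ j ≤ k + l, a ^ ρ (j + 1) * f.eval (ρ (j + 1)) = g.eval (ρ (j + 1))) :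
    g = C (g.eval (ρ 1)) * taylor (-ρ 1) (padeNum a (fun j => ρ (j + 1) - ρ 1) k l) := by
  have htranslate : taylor (ρ 1) g = C ((taylor (ρ 1) g).eval 0) *
      padeNum a (fun j => ρ (j + 1) - ρ 1) k l := by
    refine eq_C_mul_padeNum ha (IsExponentSeq.shift hρ) (p := a ^ ρ 1 • taylor (ρ 1) f)
      (Submodule.smul_mem _ _ (taylor_mem_degreeLT.2 hf)) (taylor_mem_degreeLT.2 hg) fun j hj => ?_
    rw [eval_smul, taylor_eval, taylor_eval, sub_add_cancel, ← h j hj, smul_eq_mul, ← mul_assoc,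
      ← Real.rpow_add ha.1, sub_add_cancel]
  simpa only [taylor_taylor, taylor_mul, taylor_C, taylor_eval, neg_add_cancel, taylor_zero,
    zero_add] using congrArg (taylor (-ρ 1)) htranslate

theorem exists_padeNum_succ_sub_padeNum_succ (ha : a ∈ Ioo 0 1) (hρ : IsExponentSeq ρ)
    (k l : ℕ) : ∃ κ > 0, padeNum a ρ (k + 1) l - padeNum a ρ k (l + 1) =
      X * (C κ * taylor (-ρ 1) (padeNum a (fun j => ρ (j + 1) - ρ 1) k l)) := by
  have hshift := IsExponentSeq.shift hρ.strictMono
  obtain ⟨f, hf, g, hg, -, hnum, hfg⟩ := exists_common_factor_X_sub_C (c := 0) ha.1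
    (sub_mem (padeDen_mem_degreeLT ha hρ (k + 1) l)
      (degreeLT_mono (by omega) (padeDen_mem_degreeLT ha hρ k (l + 1))))
    (sub_mem (degreeLT_mono (by omega) (padeNum_mem_degreeLT ha hρ (k + 1) l))
      (padeNum_mem_degreeLT ha hρ k (l + 1)))
    (by
      have h₁ := rpow_mul_padeDen_eval ha hρ (k := k + 1) (l := l) (Nat.zero_le _)
      have h₂ := rpow_mul_padeDen_eval ha hρ (k := k) (l := l + 1) (Nat.zero_le _)
      rw [hρ.zero] at h₁ h₂
      rw [eval_sub, eval_sub, mul_sub, h₁, h₂])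
    (by rw [eval_sub, padeNum_eval_zero ha hρ, padeNum_eval_zero ha hρ, sub_self])
  have hg_eq := eq_C_mul_taylor_padeNum ha hρ.strictMono hf hg fun j hj =>
    hfg _ (hρ.pos j.succ_pos).ne' (by
      rw [eval_sub, eval_sub, mul_sub, rpow_mul_padeDen_eval ha hρ (by omega),
        rpow_mul_padeDen_eval ha hρ (by omega)])
  rw [C_0, sub_zero] at hnum
  refine ⟨g.eval (ρ 1), ?_, by rw [hnum, ← hg_eq]⟩
  have hcoeff := congrArg (fun f : ℝ[X] => f.coeff (l + 1)) hnum
  simp only [coeff_sub, coeff_X_mul] at hcoeff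
  rw [coeff_eq_zero_of_mem_degreeLT (padeNum_mem_degreeLT ha hρ (k + 1) l), hg_eq, coeff_C_mul,
    coeff_taylor_of_mem_degreeLT (padeNum_mem_degreeLT ha hshift k l)] at hcoeff
  refine pos_of_mul_pos_left ((padeNum_coeff_sign ha hρ k (l + 1)).trans_eq ?_)
    (padeNum_coeff_sign ha hshift k l).le
  rw [pow_succ]
  linear_combination (-1) ^ l * hcoeff

theorem padeNum_right_zero (ha : a ∈ Ioo 0 1) (hρ : IsExponentSeq ρ) (k : ℕ) :
    padeNum a ρ k 0 = 1 := by
  rw [eq_C_of_mem_degreeLT_one (padeNum_mem_degreeLT ha hρ k 0), coeff_zero_eq_eval_zero,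
    padeNum_eval_zero ha hρ, C_1]

theorem padeNum_left_zero_eval (ha : a ∈ Ioo 0 1) (hρ : IsExponentSeq ρ) {l j : ℕ}
    (hj : j ≤ l) : (padeNum a ρ 0 l).eval (ρ j) = a ^ ρ j := by
  have hconst := eq_C_of_mem_degreeLT_one (padeDen_mem_degreeLT ha hρ 0 l)
  have hden : ∀ i ≤ l, a ^ ρ i * (padeDen a ρ 0 l).coeff 0 = (padeNum a ρ 0 l).eval (ρ i) := by
    intro i hi
    rw [← rpow_mul_padeDen_eval ha hρ (by omega), hconst, eval_C, coeff_C_zero]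
  have h0 := hden 0 (Nat.zero_le l)
  rw [hρ.zero, padeNum_eval_zero ha hρ, Real.rpow_zero, one_mul] at h0
  rw [← hden j hj, h0, mul_one]

end Pade

section ControlPointValues

open Polynomial

variable {a : ℝ} {ρ : ℕ → ℝ} {k l : ℕ}

theorem padeNum_eval_sub (ha : a ∈ Ioo 0 1) (hρ : IsExponentSeq ρ) (k l : ℕ) :
    ∃ κ > 0, ∀ z, (padeNum a ρ (k + 1) l).eval z - (padeNum a ρ k (l + 1)).eval z =
      κ * z * (padeNum a (fun j => ρ (j + 1) - ρ 1) k l).eval (z - ρ 1) := by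
  obtain ⟨κ, hκ, h⟩ := exists_padeNum_succ_sub_padeNum_succ ha hρ k l
  refine ⟨κ, hκ, fun z => ?_⟩
  rw [← eval_sub, h, eval_mul, eval_mul, eval_X, eval_C, taylor_eval, ← sub_eq_add_neg]
  ring

theorem antidiagonal_le {g : ℕ → ℕ → ℝ} {N : ℕ}
    (hg : ∀ k l, k + l + 1 = N → g k (l + 1) ≤ g (k + 1) l) (d : ℕ) :
    ∀ k l, k + l + d = N → g k (l + d) ≤ g (k + d) l := by
  induction d with
  | zero => exact fun k l _ => le_rfl
  | succ d ih =>
    intro k l h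
    have hfirst := ih k (l + 1) (by omega)
    have hlast := hg (k + d) l (by omega)
    rw [show l + 1 + d = l + (d + 1) by ring] at hfirst
    exact hfirst.trans hlast

theorem padeNum_eval_mem_Icc (ha : a ∈ Ioo 0 1) (N : ℕ) : ∀ {ρ : ℕ → ℝ}, IsExponentSeq ρ →
    ∀ k l, k + l = N → ∀ j ≤ N, (padeNum a ρ k l).eval (ρ j) ∈ Icc (a ^ ρ j) 1 := by
  induction N with
  | zero =>
    intro ρ hρ k l hkl j hj
    obtain ⟨rfl, rfl⟩ : l = 0 ∧ j = 0 := by omega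
    simp [padeNum_right_zero ha hρ, hρ.zero]
  | succ N ih =>
    intro ρ hρ k l hkl j hj
    have hstep : ∀ k l, k + l + 1 = N + 1 →
        (padeNum a ρ k (l + 1)).eval (ρ j) ≤ (padeNum a ρ (k + 1) l).eval (ρ j) := by
      intro k l hkl
      obtain ⟨κ, hκ, h⟩ := padeNum_eval_sub ha hρ k l
      rw [← sub_nonneg, h]
      cases j with
      | zero => rw [hρ.zero, mul_zero, zero_mul]
      | succ j =>
        have hshift := ih (IsExponentSeq.shift hρ.strictMono) k l (by omega) j (by omega)
        exact mul_nonneg (mul_nonneg hκ.le (hρ.nonneg _))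
          ((Real.rpow_pos_of_pos ha.1 _).le.trans hshift.1)
    have hle := antidiagonal_le (g := fun k l => (padeNum a ρ k l).eval (ρ j)) hstep
    constructor
    · simpa [padeNum_left_zero_eval ha hρ (by omega : j ≤ l + k)] using hle k 0 l (by omega)
    · simpa [padeNum_right_zero ha hρ] using hle l k 0 (by omega)

theorem padeNum_eval_pos (ha : a ∈ Ioo 0 1) (hρ : IsExponentSeq ρ) {j : ℕ} (hj : j ≤ k + l) :
    0 < (padeNum a ρ k l).eval (ρ j) :=
  (Real.rpow_pos_of_pos ha.1 _).trans_le (padeNum_eval_mem_Icc ha _ hρ k l rfl j hj).1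

theorem padeNum_eval_step_mem_Icc (ha : a ∈ Ioo 0 1) (hρ : IsExponentSeq ρ) {j : ℕ}
    (hj : j ≤ k + l + 1) :
    (padeNum a ρ (k + 1) l).eval (ρ j) - (padeNum a ρ k (l + 1)).eval (ρ j) ∈ Icc 0 (ρ j / ρ 1 *
      ((padeNum a ρ (k + 1) l).eval (ρ 1) - (padeNum a ρ k (l + 1)).eval (ρ 1))) := by
  have hshift := IsExponentSeq.shift hρ.strictMono
  obtain ⟨κ, hκ, h⟩ := padeNum_eval_sub ha hρ k l
  rw [h, h, sub_self, padeNum_eval_zero ha hshift]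
  cases j with
  | zero => simp [hρ.zero]
  | succ j =>
    have hmem := padeNum_eval_mem_Icc ha (k + l) hshift k l rfl j (by omega)
    have hκj : 0 ≤ κ * ρ (j + 1) := mul_nonneg hκ.le (hρ.nonneg _)
    have hρ1 : ρ 1 ≠ 0 := (hρ.pos one_pos).ne'
    rw [show ρ (j + 1) / ρ 1 * (κ * ρ 1 * 1) = κ * ρ (j + 1) by field_simp]
    exact ⟨mul_nonneg hκj ((Real.rpow_pos_of_pos ha.1 _).le.trans hmem.1),
      mul_le_of_le_one_right hκj hmem.2⟩

theorem abs_padeNum_eval_sub_le (ha : a ∈ Ioo 0 1) (hρ : IsExponentSeq ρ) {m i i' j : ℕ}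
    (hi : i ≤ m) (hi' : i' ≤ m) (hj : j ≤ m) :
    |(padeNum a ρ i (m - i)).eval (ρ j) - (padeNum a ρ i' (m - i')).eval (ρ j)| ≤ ρ j / ρ 1 *
      |(padeNum a ρ i (m - i)).eval (ρ 1) - (padeNum a ρ i' (m - i')).eval (ρ 1)| := by
  wlog h : i' ≤ i generalizing i i'
  · rw [abs_sub_comm, abs_sub_comm (eval (ρ 1) _)]
    exact this hi' hi (by omega)
  have hmono := antidiagonal_le (N := m) (g := fun k l => (padeNum a ρ k l).eval (ρ j))
    (fun k l hkl => sub_nonneg.1 (padeNum_eval_step_mem_Icc ha hρ (by omega)).1)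
    (i - i') i' (m - i) (by omega)
  have hlip := antidiagonal_le (N := m)
    (g := fun k l => ρ j / ρ 1 * (padeNum a ρ k l).eval (ρ 1) - (padeNum a ρ k l).eval (ρ j))
    (fun k l hkl => by linarith [(padeNum_eval_step_mem_Icc ha hρ (by omega : j ≤ k + l + 1)).2])
    (i - i') i' (m - i) (by omega)
  rw [show i' + (i - i') = i by omega, show m - i + (i - i') = m - i' by omega] at hmono hlip
  rw [abs_of_nonneg (sub_nonneg.2 hmono)]
  refine le_trans ?_ (mul_le_mul_of_nonneg_left (le_abs_self _)
    (div_nonneg (hρ.nonneg j) (hρ.nonneg 1)))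
  linarith

-- `τ` makes the difference of the two Padé pairs vanish at the last node, where the common factor
-- `X - R` can then be cancelled.
theorem exists_padeNum_corner_cutting (ha : a ∈ Ioo 0 1) (hρ : IsExponentSeq ρ) (k l : ℕ) :
    ∃ τ ∈ Icc (0 : ℝ) 1, padeNum a ρ k (l + 1) =
      (1 - τ) • ((1 - C (ρ (k + l + 1))⁻¹ * X) * padeNum a ρ k l) + τ • padeNum a ρ (k + 1) l := by
  set R := ρ (k + l + 1)
  set τ := (padeNum a ρ k (l + 1)).eval R / (padeNum a ρ (k + 1) l).eval R
  have hR : R ≠ 0 := (hρ.pos (Nat.succ_pos _)).ne'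
  have hnum₁ : 0 < (padeNum a ρ (k + 1) l).eval R := padeNum_eval_pos ha hρ (by omega)
  have hnum₂ : 0 < (padeNum a ρ k (l + 1)).eval R := padeNum_eval_pos ha hρ (by omega)
  have hle : (padeNum a ρ k (l + 1)).eval R ≤ (padeNum a ρ (k + 1) l).eval R :=
    sub_nonneg.1 (padeNum_eval_step_mem_Icc ha hρ le_rfl).1
  have hw : ∀ j ≤ k + l + 1,
      a ^ ρ j * (padeDen a ρ k (l + 1) - τ • padeDen a ρ (k + 1) l).eval (ρ j) =
        (padeNum a ρ k (l + 1) - τ • padeNum a ρ (k + 1) l).eval (ρ j) := by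
    intro j hj
    simp only [eval_sub, eval_smul, smul_eq_mul]
    linear_combination rpow_mul_padeDen_eval ha hρ (k := k) (l := l + 1) (j := j) (by omega) -
      τ * rpow_mul_padeDen_eval ha hρ (k := k + 1) (l := l) (j := j) (by omega)
  obtain ⟨f, hf, g, hg, -, hnum, hfg⟩ := exists_common_factor_X_sub_C (c := R) ha.1
    (sub_mem (degreeLT_mono (by omega) (padeDen_mem_degreeLT ha hρ k (l + 1)))
      (Submodule.smul_mem _ τ (padeDen_mem_degreeLT ha hρ (k + 1) l)))
    (sub_mem (padeNum_mem_degreeLT ha hρ k (l + 1)) (Submodule.smul_mem _ τ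
      (degreeLT_mono (by omega) (padeNum_mem_degreeLT ha hρ (k + 1) l)))) (hw _ le_rfl)
    (by rw [eval_sub, eval_smul, smul_eq_mul, div_mul_cancel₀ _ hnum₁.ne', sub_self])
  have hg_eq := eq_C_mul_padeNum ha hρ hf hg fun j hj =>
    hfg _ (hρ.strictMono (by omega : j < k + l + 1)).ne (hw j (by omega))
  have hg0 : 1 - τ = -R * g.eval 0 := by
    have := congrArg (eval 0) hnum
    simpa [padeNum_eval_zero ha hρ] using this
  refine ⟨τ, ⟨div_nonneg hnum₂.le hnum₁.le, (div_le_one hnum₁).2 hle⟩, sub_eq_iff_eq_add.1 ?_⟩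
  have hCR : C R * C R⁻¹ = 1 := by rw [← C_mul, mul_inv_cancel₀ hR, C_1]
  rw [hnum, hg0, smul_eq_C_mul, C_mul, C_neg]
  nth_rw 1 [hg_eq]
  linear_combination (-C (g.eval 0) * X * padeNum a ρ k l) * hCR

/-- The value at `z = ρ j` of this polynomial is the `i`-th control point of `t ^ ρ j` over `[0, 1]`
in the Müntz space of the exponents `ρ 0, …, ρ m`. -/
noncomputable def limitNum (ρ : ℕ → ℝ) (i m : ℕ) : ℝ[X] :=
  ∏ s ∈ Finset.Ioc i m, (1 - C (ρ s)⁻¹ * X)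

theorem limitNum_eval (ρ : ℕ → ℝ) (i m : ℕ) (z : ℝ) :
    (limitNum ρ i m).eval z = ∏ s ∈ Finset.Ioc i m, (1 - z / ρ s) := by
  rw [limitNum, eval_prod]
  refine Finset.prod_congr rfl fun s _ => ?_
  rw [eval_sub, eval_one, eval_mul, eval_C, eval_X, div_eq_inv_mul]

theorem padeNum_mem_convexHull (ha : a ∈ Ioo 0 1) (hρ : IsExponentSeq ρ) (l : ℕ) :
    ∀ k, padeNum a ρ k l ∈ convexHull ℝ {p | ∃ i ≤ k + l, p = limitNum ρ i (k + l)} := by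
  induction l with
  | zero =>
    intro k
    refine subset_convexHull ℝ _ ⟨k, le_rfl, ?_⟩
    rw [padeNum_right_zero ha hρ, limitNum, add_zero, Finset.Ioc_self, Finset.prod_empty]
  | succ l ih =>
    intro k
    obtain ⟨τ, hτ, h⟩ := exists_padeNum_corner_cutting ha hρ k l
    have hcut : (1 - C (ρ (k + l + 1))⁻¹ * X) * padeNum a ρ k l ∈
        convexHull ℝ {p | ∃ i ≤ k + l + 1, p = limitNum ρ i (k + l + 1)} := by
      have himage := mem_image_of_mem
        (LinearMap.mulLeft ℝ (1 - C (ρ (k + l + 1))⁻¹ * X)) (ih k)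
      rw [LinearMap.image_convexHull] at himage
      refine convexHull_mono ?_ himage
      rintro _ ⟨_, ⟨i, hi, rfl⟩, rfl⟩
      refine ⟨i, by omega, ?_⟩
      rw [LinearMap.mulLeft_apply, limitNum, limitNum, Finset.prod_Ioc_succ_top (by omega),
        mul_comm]
    have hnext := ih (k + 1)
    rw [add_right_comm] at hnext
    rw [h]
    exact convex_convexHull ℝ _ hcut hnext (sub_nonneg.2 hτ.2) hτ.1 (sub_add_cancel 1 τ)

end ControlPointValues

section MuntzProducts

/-- Limits along this filter on pairs `(i, m)` are limits as `m → ∞`, uniformly in `i ≤ m`. It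
expresses uniformity over the control points of Müntz spaces of growing dimension. -/
def triangleAtTop : Filter (ℕ × ℕ) :=
  comap Prod.snd atTop ⊓ 𝓟 {p | p.1 ≤ p.2}

theorem eventually_triangleAtTop {Q : ℕ × ℕ → Prop} :
    (∀ᶠ p in triangleAtTop, Q p) ↔ ∀ᶠ m in atTop, ∀ i ≤ m, Q (i, m) := by
  rw [triangleAtTop, eventually_inf_principal, eventually_comap]
  refine eventually_congr (Eventually.of_forall fun m => ⟨fun h i hi => h (i, m) rfl hi, ?_⟩)
  rintro h ⟨i, _⟩ rfl hi
  exact h i hi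

variable {ι : Type*} {T : Finset ι} {x : ι → ℝ}

theorem prod_one_sub_le_exp_neg_sum (hx : ∀ s ∈ T, x s ≤ 1) :
    ∏ s ∈ T, (1 - x s) ≤ Real.exp (-∑ s ∈ T, x s) := by
  rw [← Finset.sum_neg_distrib, Real.exp_sum]
  exact Finset.prod_le_prod (fun s hs => sub_nonneg.2 (hx s hs))
    fun s _ => Real.one_sub_le_exp_neg (x s)

theorem exp_neg_mul_sum_le_prod_one_sub {δ : ℝ} (hδ : δ ∈ Icc 0 (1 / 2))
    (hx : ∀ s ∈ T, x s ∈ Icc 0 δ) :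
    Real.exp (-((1 + 2 * δ) * ∑ s ∈ T, x s)) ≤ ∏ s ∈ T, (1 - x s) := by
  rw [Finset.mul_sum, ← Finset.sum_neg_distrib, Real.exp_sum]
  refine Finset.prod_le_prod (fun s _ => (Real.exp_pos _).le) fun s hs => ?_
  obtain ⟨h0, h1⟩ := hx s hs
  have hpos : 0 < 1 - x s := by linarith [hδ.2]
  rw [Real.exp_neg, inv_le_comm₀ (Real.exp_pos _) hpos]
  refine le_trans ?_ (Real.add_one_le_exp _)
  rw [inv_le_iff_one_le_mul₀ hpos]
  nlinarith [mul_nonneg h0 (sub_nonneg.2 h1), mul_nonneg (mul_nonneg h0 hδ.1)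
    (by linarith [hδ.2] : 0 ≤ 1 - 2 * x s)]

theorem abs_prod_one_sub_sub_exp_le {δ : ℝ} (hδ : δ ∈ Icc 0 (1 / 2))
    (hx : ∀ s ∈ T, x s ∈ Icc 0 δ) :
    |∏ s ∈ T, (1 - x s) - Real.exp (-∑ s ∈ T, x s)| ≤ 2 * δ := by
  have hupper := prod_one_sub_le_exp_neg_sum fun s hs => show x s ≤ 1 by
    linarith [(hx s hs).2, hδ.2]
  have hlower := exp_neg_mul_sum_le_prod_one_sub hδ hx
  set S := ∑ s ∈ T, x s
  have hS : S * Real.exp (-S) ≤ 1 := by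
    rw [Real.exp_neg, ← div_eq_mul_inv, div_le_one (Real.exp_pos _)]
    linarith [Real.add_one_le_exp S]
  rw [abs_sub_comm, abs_of_nonneg (sub_nonneg.2 hupper), sub_le_comm]
  calc Real.exp (-S) - 2 * δ
      ≤ Real.exp (-S) * (-(2 * δ * S) + 1) := by nlinarith [mul_le_mul_of_nonneg_left hS hδ.1]
    _ ≤ Real.exp (-S) * Real.exp (-(2 * δ * S)) :=
        mul_le_mul_of_nonneg_left (Real.add_one_le_exp _) (Real.exp_pos _).le
    _ = Real.exp (-((1 + 2 * δ) * S)) := by rw [← Real.exp_add]; ring_nf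
    _ ≤ _ := hlower

theorem tendsto_sum_Ioc_atTop {x : ℕ → ℝ}
    (hsum : Tendsto (fun N => ∑ s ∈ Finset.Icc 1 N, x s) atTop atTop) (i : ℕ) :
    Tendsto (fun m => ∑ s ∈ Finset.Ioc i m, x s) atTop atTop := by
  refine (tendsto_atTop_add_const_right atTop (-∑ s ∈ Finset.Ioc 0 i, x s) hsum).congr' ?_
  filter_upwards [eventually_ge_atTop i] with m hm
  rw [show Finset.Icc 1 m = Finset.Ioc 0 m from Finset.Icc_add_one_left_eq_Ioc 0 m,
    ← Finset.sum_Ioc_consecutive x (Nat.zero_le i) hm,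
    add_neg_cancel_comm]

theorem tendsto_exp_neg_sum_Ioc_zero {x : ℕ → ℝ}
    (hsum : Tendsto (fun N => ∑ s ∈ Finset.Icc 1 N, x s) atTop atTop) (i : ℕ) :
    Tendsto (fun m => Real.exp (-∑ s ∈ Finset.Ioc i m, x s)) atTop (𝓝 0) :=
  Real.tendsto_exp_neg_atTop_nhds_zero.comp (tendsto_sum_Ioc_atTop hsum i)

theorem tendsto_prod_Ioc_one_sub_zero {x : ℕ → ℝ} (hx : ∀ᶠ s in atTop, x s ≤ 1)
    (hsum : Tendsto (fun N => ∑ s ∈ Finset.Icc 1 N, x s) atTop atTop) (i : ℕ) :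
    Tendsto (fun m => ∏ s ∈ Finset.Ioc i m, (1 - x s)) atTop (𝓝 0) := by
  obtain ⟨L, hL⟩ := eventually_atTop.1 (hx.and (eventually_ge_atTop i))
  have hle : ∀ m, ∀ s ∈ Finset.Ioc L m, x s ≤ 1 := fun m s hs =>
    (hL s (Finset.mem_Ioc.1 hs).1.le).1
  have htail : Tendsto (fun m => ∏ s ∈ Finset.Ioc L m, (1 - x s)) atTop (𝓝 0) :=
    squeeze_zero (fun m => Finset.prod_nonneg fun s hs => sub_nonneg.2 (hle m s hs))
      (fun m => prod_one_sub_le_exp_neg_sum (hle m)) (tendsto_exp_neg_sum_Ioc_zero hsum L)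
  have hmul := htail.const_mul (∏ s ∈ Finset.Ioc i L, (1 - x s))
  rw [mul_zero] at hmul
  refine hmul.congr' ?_
  filter_upwards [eventually_ge_atTop L] with m hm
  exact Finset.prod_Ioc_consecutive _ (hL L le_rfl).2 hm

theorem tendsto_prod_one_sub_sub_exp {x : ℕ → ℝ} (hx : ∀ᶠ s in atTop, 0 ≤ x s)
    (hx0 : Tendsto x atTop (𝓝 0))
    (hsum : Tendsto (fun N => ∑ s ∈ Finset.Icc 1 N, x s) atTop atTop) :
    Tendsto (fun p : ℕ × ℕ => ∏ s ∈ Finset.Ioc p.1 p.2, (1 - x s) -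
      Real.exp (-∑ s ∈ Finset.Ioc p.1 p.2, x s)) triangleAtTop (𝓝 0) := by
  have hx1 : ∀ᶠ s in atTop, x s ≤ 1 := hx0.eventually_le_const one_pos
  rw [Metric.tendsto_nhds]
  intro ε hε
  simp only [dist_zero_right, Real.norm_eq_abs]
  obtain ⟨δ, hδ0, hδ⟩ := exists_between (lt_min one_half_pos (half_pos hε))
  obtain ⟨hδ1, hδε⟩ := lt_min_iff.1 hδ
  obtain ⟨L, hL⟩ := eventually_atTop.1 (hx.and (hx0.eventually_le_const hδ0))
  have hsmall : ∀ᶠ m in atTop, ∀ i ∈ Finset.range L, |∏ s ∈ Finset.Ioc i m, (1 - x s) -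
      Real.exp (-∑ s ∈ Finset.Ioc i m, x s)| < ε :=
    (Finset.eventually_all _).2 fun i _ => by
      have hsub := (tendsto_prod_Ioc_one_sub_zero hx1 hsum i).sub
        (tendsto_exp_neg_sum_Ioc_zero hsum i)
      rw [sub_zero] at hsub
      simpa only [Real.norm_eq_abs, dist_zero_right] using Metric.tendsto_nhds.1 hsub ε hε
  rw [eventually_triangleAtTop]
  filter_upwards [hsmall] with m hm i _
  rcases lt_or_ge i L with hi | hi
  · exact hm i (Finset.mem_range.2 hi)
  · have hlarge := abs_prod_one_sub_sub_exp_le (T := Finset.Ioc i m) ⟨hδ0.le, hδ1.le⟩ fun s hs =>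
      hL s (hi.trans (Finset.mem_Ioc.1 hs).1.le)
    linarith

end MuntzProducts

section VonGolitschek

-- At an interior maximum the differential equation `x h' = ρ h + g` reads `ρ h = -g`.
theorem le_div_of_hasDerivAt {h g : ℝ → ℝ} {ρ M : ℝ} (hρ : 0 < ρ) (hM : 0 ≤ M)
    (hc : ContinuousOn h (Icc 0 1)) (h0 : h 0 = 0) (h1 : h 1 = 0)
    (hd : ∀ x ∈ Ioo (0 : ℝ) 1, HasDerivAt h ((ρ * h x + g x) / x) x)
    (hg : ∀ x ∈ Ioo (0 : ℝ) 1, -M ≤ g x) {x : ℝ} (hx : x ∈ Icc (0 : ℝ) 1) : h x ≤ M / ρ := by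
  obtain ⟨y, hy, hmax⟩ := isCompact_Icc.exists_isMaxOn ⟨x, hx⟩ hc
  refine (hmax hx).trans ?_
  rcases hy.1.eq_or_lt with rfl | hy0
  · rw [h0]; positivity
  rcases hy.2.eq_or_lt with rfl | hy1
  · rw [h1]; positivity
  have hcrit := (hmax.isLocalMax (Icc_mem_nhds hy0 hy1)).hasDerivAt_eq_zero (hd y ⟨hy0, hy1⟩)
  rw [div_eq_zero_iff, or_iff_left hy0.ne'] at hcrit
  rw [le_div_iff₀ hρ]
  linarith [hg y ⟨hy0, hy1⟩]

theorem abs_le_div_of_hasDerivAt {h g : ℝ → ℝ} {ρ M : ℝ} (hρ : 0 < ρ) (hM : 0 ≤ M)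
    (hc : ContinuousOn h (Icc 0 1)) (h0 : h 0 = 0) (h1 : h 1 = 0)
    (hd : ∀ x ∈ Ioo (0 : ℝ) 1, HasDerivAt h ((ρ * h x + g x) / x) x)
    (hg : ∀ x ∈ Ioo (0 : ℝ) 1, |g x| ≤ M) {x : ℝ} (hx : x ∈ Icc (0 : ℝ) 1) : |h x| ≤ M / ρ := by
  refine abs_le'.2 ⟨le_div_of_hasDerivAt hρ hM hc h0 h1 hd (fun x hx => (abs_le.1 (hg x hx)).1) hx,
    le_div_of_hasDerivAt (h := -h) (g := -g) hρ hM hc.neg (by simp [h0]) (by simp [h1])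
      (fun x hx => (hd x hx).neg.congr_deriv ?_)
      (fun x hx => neg_le_neg (abs_le.1 (hg x hx)).2) hx⟩
  simp only [Pi.neg_apply]
  ring

theorem hasDerivAt_rpow_sub_rpow (s ρ : ℝ) {x : ℝ} (hx : x ≠ 0) :
    HasDerivAt (fun x => x ^ s - x ^ ρ) ((ρ * (x ^ s - x ^ ρ) + (s - ρ) * x ^ s) / x) x := by
  refine ((Real.hasDerivAt_rpow_const (Or.inl hx)).sub
    (Real.hasDerivAt_rpow_const (Or.inl hx))).congr_deriv ?_
  rw [Real.rpow_sub_one hx, Real.rpow_sub_one hx]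
  ring

theorem abs_rpow_sub_rpow_sub_sum_le {ι : Type*} {T : Finset ι} {s d : ι → ℝ} {y ρ M : ℝ}
    (hs : ∀ j ∈ T, 0 < s j) (hsρ : ∀ j ∈ T, s j ≠ ρ) (hy : 0 < y) (hρ : 0 < ρ)
    (hd : ∀ x ∈ Icc (0 : ℝ) 1, |x ^ y - ∑ j ∈ T, d j * x ^ s j| ≤ M) {x : ℝ}
    (hx : x ∈ Icc (0 : ℝ) 1) :
    |x ^ y - x ^ ρ - ∑ j ∈ T, d j * (y - ρ) / (s j - ρ) * (x ^ s j - x ^ ρ)| ≤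
      |1 - y / ρ| * M := by
  have hM : 0 ≤ M := (abs_nonneg _).trans (hd x hx)
  have hbound : |1 - y / ρ| * M = |y - ρ| * M / ρ := by
    rw [one_sub_div hρ.ne', abs_div, abs_of_pos hρ, abs_sub_comm]
    ring
  rw [hbound]
  refine abs_le_div_of_hasDerivAt
    (h := fun x => x ^ y - x ^ ρ - ∑ j ∈ T, d j * (y - ρ) / (s j - ρ) * (x ^ s j - x ^ ρ))
    (g := fun x => (y - ρ) * (x ^ y - ∑ j ∈ T, d j * x ^ s j)) hρ (by positivity) ?_ ?_ ?_ ?_ ?_ hx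
  · have hcont : ∀ {t : ℝ}, 0 < t → Continuous fun x : ℝ => x ^ t := fun ht =>
      Real.continuous_rpow_const ht.le
    exact (((hcont hy).sub (hcont hρ)).sub (continuous_finsetSum _ fun j hj =>
      ((hcont (hs j hj)).sub (hcont hρ)).const_mul _)).continuousOn
  · simp only [Real.zero_rpow hy.ne', Real.zero_rpow hρ.ne', sub_zero, zero_sub, neg_eq_zero]
    exact Finset.sum_eq_zero fun j hj => by rw [Real.zero_rpow (hs j hj).ne', mul_zero]
  · simp
  · intro x hx
    have hx0 : x ≠ 0 := hx.1.ne'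
    refine ((hasDerivAt_rpow_sub_rpow y ρ hx0).fun_sub (HasDerivAt.fun_sum fun j _ =>
      (hasDerivAt_rpow_sub_rpow (s j) ρ hx0).const_mul _)).congr_deriv ?_
    have hcancel : ∀ j ∈ T, d j * (y - ρ) / (s j - ρ) *
        ((ρ * (x ^ s j - x ^ ρ) + (s j - ρ) * x ^ s j) / x) =
        (ρ * (d j * (y - ρ) / (s j - ρ) * (x ^ s j - x ^ ρ)) + (y - ρ) * (d j * x ^ s j)) / x := by
      intro j hj
      have := sub_ne_zero.2 (hsρ j hj)
      field_simp
    rw [Finset.sum_congr rfl hcancel, ← Finset.sum_div, Finset.sum_add_distrib, ← Finset.mul_sum,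
      ← Finset.mul_sum]
    ring
  · intro x hx
    rw [abs_mul]
    exact mul_le_mul_of_nonneg_left (hd x (Ioo_subset_Icc_self hx)) (abs_nonneg _)

-- Von Golitschek's construction: the error obeys a differential equation whose right-hand side is
-- the error for one exponent fewer.
theorem exists_abs_rpow_sub_sum_le {ι : Type*} (T : Finset ι) {s : ι → ℝ} (hs : ∀ j ∈ T, 0 < s j)
    (hinj : InjOn s T) {y : ℝ} (hy : 0 < y) :
    ∃ d : ι → ℝ, ∀ x ∈ Icc (0 : ℝ) 1,
      |x ^ y - ∑ j ∈ T, d j * x ^ s j| ≤ ∏ j ∈ T, |1 - y / s j| := by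
  classical
  induction T using Finset.induction_on with
  | empty =>
    refine ⟨0, fun x hx => ?_⟩
    rw [Finset.sum_empty, Finset.prod_empty, sub_zero, abs_of_nonneg (Real.rpow_nonneg hx.1 _)]
    exact Real.rpow_le_one hx.1 hx.2 hy.le
  | insert i T hi ih =>
    rw [Finset.coe_insert, injOn_insert (by simpa using hi)] at hinj
    rw [Finset.forall_mem_insert] at hs
    obtain ⟨d, hd⟩ := ih hs.2 hinj.1
    let e : ι → ℝ := fun j => d j * (y - s i) / (s j - s i)
    refine ⟨Function.update e i (1 - ∑ j ∈ T, e j), fun x hx => ?_⟩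
    have hstep := abs_rpow_sub_rpow_sub_sum_le hs.2
      (fun j hj h => hinj.2 ⟨j, hj, h⟩) hy hs.1 hd hx
    have hupdate : ∀ j ∈ T, Function.update e i (1 - ∑ j ∈ T, e j) j * x ^ s j = e j * x ^ s j :=
      fun j hj => by rw [Function.update_of_ne (ne_of_mem_of_not_mem hj hi)]
    rw [Finset.prod_insert hi, Finset.sum_insert hi, Function.update_self,
      Finset.sum_congr rfl hupdate]
    refine (congrArg abs ?_).trans_le hstep
    simp only [mul_sub, Finset.sum_sub_distrib, ← Finset.sum_mul, e]
    ring

end VonGolitschek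

section Approximation

variable {a : ℝ} {r : ℕ → ℝ}

theorem tendsto_sum_div_atTop
    (hMuntz : Tendsto (fun N : ℕ => ∑ i ∈ Finset.Icc 1 N, 1 / r i) atTop atTop) {z : ℝ}
    (hz : 0 < z) : Tendsto (fun N : ℕ => ∑ i ∈ Finset.Icc 1 N, z / r i) atTop atTop := by
  simpa only [Finset.mul_sum, mul_one_div] using hMuntz.const_mul_atTop hz

theorem tendsto_limitNum_eval_sub_rpow (hlim : Tendsto r atTop atTop)
    (hMuntz : Tendsto (fun N : ℕ => ∑ i ∈ Finset.Icc 1 N, 1 / r i) atTop atTop) {z : ℝ}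
    (hz : 0 < z) :
    Tendsto (fun p : ℕ × ℕ => (limitNum r p.1 p.2).eval z -
      Real.exp (-∑ s ∈ Finset.Ioc p.1 p.2, 1 / r s) ^ z) triangleAtTop (𝓝 0) := by
  refine (tendsto_prod_one_sub_sub_exp (x := fun s => z / r s) ?_ (hlim.const_div_atTop z)
    (tendsto_sum_div_atTop hMuntz hz)).congr fun p => ?_
  · filter_upwards [hlim.eventually_ge_atTop 0] with s hs
    exact div_nonneg hz.le hs
  · rw [limitNum_eval, ← Real.exp_mul, neg_mul, Finset.sum_mul]
    simp only [one_div_mul_eq_div]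

theorem exists_abs_rpow_sub_sum_le_of_muntz (hr : IsExponentSeq r) (hlim : Tendsto r atTop atTop)
    (hMuntz : Tendsto (fun N : ℕ => ∑ i ∈ Finset.Icc 1 N, 1 / r i) atTop atTop)
    {y : ℝ} (hy : 0 < y) {ε : ℝ} (hε : 0 < ε) :
    ∃ (n : ℕ) (d : ℕ → ℝ), ∀ x ∈ Icc (0 : ℝ) 1,
      |x ^ y - ∑ j ∈ Finset.Ioc 0 n, d j * x ^ r j| ≤ ε := by
  have hprod := (tendsto_prod_Ioc_one_sub_zero
    ((hlim.const_div_atTop y).eventually_le_const one_pos) (tendsto_sum_div_atTop hMuntz hy) 0).abs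
  rw [abs_zero] at hprod
  obtain ⟨n, hn⟩ := (hprod.eventually_le_const hε).exists
  obtain ⟨d, hd⟩ := exists_abs_rpow_sub_sum_le (Finset.Ioc 0 n) (s := r)
    (fun j hj => hr.pos (Finset.mem_Ioc.1 hj).1) hr.strictMono.injective.injOn hy
  exact ⟨n, d, fun x hx => (hd x hx).trans (by rwa [← Finset.abs_prod])⟩

-- The control points `limitNum` asymptotically lie on the curve `x ↦ (x ^ r 1, …, x ^ r n)`.
theorem eventually_limitNum_sq_le (hr : IsExponentSeq r) (hlim : Tendsto r atTop atTop)
    (hMuntz : Tendsto (fun N : ℕ => ∑ i ∈ Finset.Icc 1 N, 1 / r i) atTop atTop)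
    {n : ℕ} {d : ℕ → ℝ} {ε ε' : ℝ} (hε : ε < ε')
    (hd : ∀ x ∈ Icc (0 : ℝ) 1, (x ^ r 1) ^ 2 ≤ ∑ j ∈ Finset.Ioc 0 n, d j * x ^ r j + ε) :
    ∀ᶠ p in triangleAtTop, (limitNum r p.1 p.2).eval (r 1) ^ 2 ≤
      ∑ j ∈ Finset.Ioc 0 n, d j * (limitNum r p.1 p.2).eval (r j) + ε' := by
  let x : ℕ × ℕ → ℝ := fun p => Real.exp (-∑ s ∈ Finset.Ioc p.1 p.2, 1 / r s)
  have hx : ∀ p, x p ∈ Icc 0 1 := fun p => ⟨(Real.exp_pos _).le, Real.exp_le_one_iff.2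
    (neg_nonpos.2 (Finset.sum_nonneg fun s _ => one_div_nonneg.2 (hr.nonneg s)))⟩
  have hconv : ∀ j, 0 < j → Tendsto (fun p => (limitNum r p.1 p.2).eval (r j) - x p ^ r j)
      triangleAtTop (𝓝 0) := fun j hj => tendsto_limitNum_eval_sub_rpow hlim hMuntz (hr.pos hj)
  have hsum : Tendsto (fun p => ∑ j ∈ Finset.Ioc 0 n,
      d j * ((limitNum r p.1 p.2).eval (r j) - x p ^ r j)) triangleAtTop (𝓝 0) := by
    simpa only [mul_zero, Finset.sum_const_zero] using tendsto_finsetSum (Finset.Ioc 0 n)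
      fun j hj => (hconv j (Finset.mem_Ioc.1 hj).1).const_mul (d j)
  have hsq : Tendsto (fun p => (limitNum r p.1 p.2).eval (r 1) ^ 2 - (x p ^ r 1) ^ 2)
      triangleAtTop (𝓝 0) := by
    have hbdd : IsBoundedUnder (· ≤ ·) triangleAtTop fun p => ‖x p ^ r 1‖ :=
      isBoundedUnder_of ⟨1, fun p => by
        rw [Real.norm_of_nonneg (Real.rpow_nonneg (hx p).1 _)]
        exact Real.rpow_le_one (hx p).1 (hx p).2 (hr.nonneg 1)⟩
    have h1 := hconv 1 one_pos
    have hadd := (h1.pow 2).add ((h1.zero_mul_isBoundedUnder_le hbdd).const_mul 2)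
    rw [zero_pow two_ne_zero, mul_zero, add_zero] at hadd
    exact hadd.congr fun p => by ring
  have hdiff := hsq.sub hsum
  rw [sub_zero] at hdiff
  filter_upwards [hdiff.eventually_le_const (sub_pos.2 hε)] with p hp
  simp only [mul_sub, Finset.sum_sub_distrib] at hp
  linarith [hd (x p) (hx p)]

theorem eventually_padeNum_sq_le (ha : a ∈ Ioo 0 1) (hr : IsExponentSeq r)
    (hlim : Tendsto r atTop atTop)
    (hMuntz : Tendsto (fun N : ℕ => ∑ i ∈ Finset.Icc 1 N, 1 / r i) atTop atTop)
    {n : ℕ} {d : ℕ → ℝ} {ε ε' : ℝ} (hε : ε < ε')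
    (hd : ∀ x ∈ Icc (0 : ℝ) 1, (x ^ r 1) ^ 2 ≤ ∑ j ∈ Finset.Ioc 0 n, d j * x ^ r j + ε) :
    ∀ᶠ m in atTop, ∀ i ≤ m, (padeNum a r i (m - i)).eval (r 1) ^ 2 ≤
      ∑ j ∈ Finset.Ioc 0 n, d j * (padeNum a r i (m - i)).eval (r j) + ε' := by
  let φ : Polynomial ℝ →ₗ[ℝ] ℝ := ∑ j ∈ Finset.Ioc 0 n, d j • Polynomial.leval (r j)
  have hφ : ∀ p, φ p = ∑ j ∈ Finset.Ioc 0 n, d j * p.eval (r j) := fun p => by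
    simp [φ, Polynomial.leval_apply]
  have hconvex : Convex ℝ {p : Polynomial ℝ | p.eval (r 1) ^ 2 ≤ φ p + ε'} := by
    have hsq := (even_two.convexOn_pow (𝕜 := ℝ)).comp_linearMap (Polynomial.leval (r 1))
    simpa only [univ_inter, mem_univ, true_and, preimage_univ, Pi.sub_apply, Function.comp_apply,
      Polynomial.leval_apply, sub_le_iff_le_add'] using
      (hsq.sub (φ.concaveOn convex_univ)).convex_le ε'
  filter_upwards [eventually_triangleAtTop.1 (eventually_limitNum_sq_le hr hlim hMuntz hε hd)]
    with m hm i hi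
  have hmem := padeNum_mem_convexHull ha hr (m - i) i
  rw [Nat.add_sub_cancel' hi] at hmem
  rw [← hφ]
  refine convexHull_min ?_ hconvex hmem
  rintro _ ⟨i', hi', rfl⟩
  exact (hm i' hi').trans_eq (by rw [hφ])

end Approximation

section EulerOperator

open Polynomial

variable {r : ℕ → ℝ} {m : ℕ} {x : ℝ}

/-- The element `∑ j, c j * t ^ r j` of the Müntz space with coefficients `c`. -/
noncomputable def muntzSum (r : ℕ → ℝ) (m : ℕ) : (Fin (m + 1) → ℝ) →ₗ[ℝ] (ℝ → ℝ) :=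
  Fintype.linearCombination ℝ fun (j : Fin (m + 1)) (t : ℝ) => t ^ r j

/-- The value at `x` of `p(θ) f`, where `f` has coefficients `c` and `θ = t d/dt` is the Euler
operator, for which `t ^ r j` is an eigenfunction with eigenvalue `r j`. -/
noncomputable def eulerEval (r : ℕ → ℝ) (m : ℕ) (x : ℝ) :
    (Fin (m + 1) → ℝ) →ₗ[ℝ] ℝ[X] →ₗ[ℝ] ℝ :=
  ∑ j : Fin (m + 1), (LinearMap.proj j : (Fin (m + 1) → ℝ) →ₗ[ℝ] ℝ).smulRight
    (x ^ r j • leval (r j))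

theorem muntzSum_apply (c : Fin (m + 1) → ℝ) (t : ℝ) :
    muntzSum r m c t = ∑ j, c j * t ^ r j := by
  simp [muntzSum, Fintype.linearCombination_apply]

theorem range_muntzSum (r : ℕ → ℝ) (m : ℕ) : LinearMap.range (muntzSum r m) = muntzSpace r m :=
  Fintype.range_linearCombination _ _

theorem muntzSum_single (j : Fin (m + 1)) (t : ℝ) :
    muntzSum r m (Pi.single j 1) t = t ^ r j := by
  simp [muntzSum_apply, Pi.single_apply]

theorem muntzSum_single_zero (hr : r 0 = 0) : muntzSum r m (Pi.single 0 1) = 1 :=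
  funext fun t => by simp [muntzSum_single, hr]

theorem eulerEval_apply (c : Fin (m + 1) → ℝ) (p : ℝ[X]) :
    eulerEval r m x c p = ∑ j, c j * (x ^ r j * p.eval (r j)) := by
  simp [eulerEval, leval_apply]

theorem iteratedDeriv_muntzSum (hx : 0 < x) (c : Fin (m + 1) → ℝ) (i : ℕ) :
    iteratedDeriv i (muntzSum r m c) x = eulerEval r m x c (descPochhammer ℝ i) / x ^ i := by
  have hsmooth : ∀ j ∈ (Finset.univ : Finset (Fin (m + 1))),
      ContDiffAt ℝ i (fun t => c j * t ^ r j) x := fun j _ =>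
    contDiffAt_const.mul (contDiffAt_id.rpow_const_of_ne hx.ne')
  rw [funext (muntzSum_apply c), iteratedDeriv_fun_sum hsmooth, eulerEval_apply, Finset.sum_div]
  refine Finset.sum_congr rfl fun j _ => ?_
  rw [iteratedDeriv_const_mul_field, iteratedDeriv_eq_iterate, Real.iter_deriv_rpow_const,
    Real.rpow_sub_natCast hx.ne']
  ring

theorem map_eq_zero_of_mem_degreeLT {φ : ℝ[X] →ₗ[ℝ] ℝ} {e : ℕ → ℝ[X]} {K : ℕ}
    (he : ∀ i, (e i).degree = i) (hφ : ∀ i < K, φ (e i) = 0) {p : ℝ[X]} (hp : p ∈ degreeLT ℝ K) :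
    φ p = 0 := by
  let S : Polynomial.Sequence ℝ := ⟨e, he⟩
  rw [← S.span_degreeLT fun i _ => (leadingCoeff_ne_zero.2 (S.ne_zero i)).isUnit] at hp
  have hle : Submodule.span ℝ (S '' Iio K) ≤ LinearMap.ker φ := by
    rw [Submodule.span_le, image_subset_iff]
    exact fun i hi => hφ i hi
  exact hle hp

theorem vanishesToOrder_muntzSum_iff (hx : 0 < x) {c : Fin (m + 1) → ℝ} {K : ℕ} :
    VanishesToOrder (muntzSum r m c) K x ↔ ∀ p ∈ degreeLT ℝ K, eulerEval r m x c p = 0 := by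
  have hdeg : ∀ i, (descPochhammer ℝ i).degree = i := fun i => by
    rw [degree_eq_natDegree (monic_descPochhammer ℝ i).ne_zero, descPochhammer_natDegree]
  have hzero : ∀ i, iteratedDeriv i (muntzSum r m c) x = 0 ↔
      eulerEval r m x c (descPochhammer ℝ i) = 0 := fun i => by
    rw [iteratedDeriv_muntzSum hx, div_eq_zero_iff, or_iff_left (pow_pos hx i).ne']
  refine ⟨fun h p hp => map_eq_zero_of_mem_degreeLT hdeg (fun i hi => (hzero i).1 (h i hi)) hp,
    fun h i hi => (hzero i).2 (h _ ?_)⟩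
  rw [mem_degreeLT, hdeg]
  exact_mod_cast hi

theorem eq_zero_of_eulerEval_eq_zero (hr : Function.Injective r) (hx : 0 < x)
    {c : Fin (m + 1) → ℝ} (h : ∀ p ∈ degreeLT ℝ (m + 1), eulerEval r m x c p = 0) : c = 0 := by
  have hinj : InjOn (fun j : Fin (m + 1) => r j) (Finset.univ : Finset (Fin (m + 1))) :=
    (hr.comp Fin.val_injective).injOn
  have hc := h (Lagrange.interpolate Finset.univ (fun j : Fin (m + 1) => r j) c)
    (mem_degreeLT.2 (by simpa using Lagrange.degree_interpolate_lt c hinj))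
  rw [eulerEval_apply, Finset.sum_eq_zero_iff_of_nonneg] at hc
  · ext j
    have hj := hc j (Finset.mem_univ j)
    rw [Lagrange.eval_interpolate_at_node c hinj (Finset.mem_univ j)] at hj
    simpa [(Real.rpow_pos_of_pos hx _).ne'] using hj
  · intro j _
    rw [Lagrange.eval_interpolate_at_node c hinj (Finset.mem_univ j), mul_left_comm]
    exact mul_nonneg (Real.rpow_nonneg hx.le _) (mul_self_nonneg _)

theorem eq_zero_of_muntzSum_eqOn_zero (hr : Function.Injective r) {a b : ℝ} (ha : 0 ≤ a)
    (hab : a < b) {c : Fin (m + 1) → ℝ} (h : EqOn (muntzSum r m c) 0 (Icc a b)) : c = 0 := by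
  obtain ⟨x, hx⟩ := nonempty_Ioo.2 hab
  have hx0 : 0 < x := ha.trans_lt hx.1
  refine eq_zero_of_eulerEval_eq_zero hr hx0
    ((vanishesToOrder_muntzSum_iff hx0).1 fun i _ => ?_)
  have hlocal : muntzSum r m c =ᶠ[𝓝 x] fun _ => 0 :=
    h.eventuallyEq_of_mem (Icc_mem_nhds hx.1 hx.2)
  rw [hlocal.iteratedDeriv_eq i]
  simp

end EulerOperator

section BernsteinBasis

open Polynomial

variable {a : ℝ} {r : ℕ → ℝ} {m : ℕ}

/-- The map sending the coefficients of an element of the Müntz space to its control points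
over `[a, 1]`. -/
noncomputable def controlMap (a : ℝ) (r : ℕ → ℝ) (m : ℕ) :
    (Fin (m + 1) → ℝ) →ₗ[ℝ] (Fin (m + 1) → ℝ) :=
  LinearMap.pi fun i => (eulerEval r m 1).flip (padeNum a r i (m - i))

theorem controlMap_apply (c : Fin (m + 1) → ℝ) (i : Fin (m + 1)) :
    controlMap a r m c i = eulerEval r m 1 c (padeNum a r i (m - i)) := rfl

theorem controlMap_apply_eq_eulerEval_padeDen (ha : a ∈ Ioo 0 1) (hr : IsExponentSeq r)
    (c : Fin (m + 1) → ℝ) (i : Fin (m + 1)) :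
    controlMap a r m c i = eulerEval r m a c (padeDen a r i (m - i)) := by
  rw [controlMap_apply, eulerEval_apply, eulerEval_apply]
  refine Finset.sum_congr rfl fun j _ => ?_
  rw [Real.one_rpow, one_mul, rpow_mul_padeDen_eval ha hr (by omega)]

theorem controlMap_single (j i : Fin (m + 1)) :
    controlMap a r m (Pi.single j 1) i = (padeNum a r i (m - i)).eval (r j) := by
  simp [controlMap_apply, eulerEval_apply, Pi.single_apply]

theorem controlMap_single_zero (ha : a ∈ Ioo 0 1) (hr : IsExponentSeq r) :
    controlMap a r m (Pi.single 0 1) = 1 :=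
  funext fun i => by simp [controlMap_single, hr.zero, padeNum_eval_zero ha hr]

theorem degree_eq_of_mem_degreeLT {p : ℝ[X]} {n : ℕ} (hp : p ∈ degreeLT ℝ (n + 1))
    (hn : p.coeff n ≠ 0) : p.degree = n :=
  degree_eq_of_le_of_coeff_ne_zero (mem_degreeLE.1 (degreeLT_succ_eq_degreeLE (R := ℝ) ▸ hp)) hn

theorem degree_padeDen (ha : a ∈ Ioo 0 1) (hr : IsExponentSeq r) (k l : ℕ) :
    (padeDen a r k l).degree = k :=
  degree_eq_of_mem_degreeLT (padeDen_mem_degreeLT ha hr k l) (coeff_padeDen_ne_zero ha hr k l)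

theorem degree_padeNum (ha : a ∈ Ioo 0 1) (hr : IsExponentSeq r) (k l : ℕ) :
    (padeNum a r k l).degree = l :=
  degree_eq_of_mem_degreeLT (padeNum_mem_degreeLT ha hr k l)
    (right_ne_zero_of_mul (padeNum_coeff_sign ha hr k l).ne')

theorem eulerEval_left_eq_zero (ha : a ∈ Ioo 0 1) (hr : IsExponentSeq r) {c : Fin (m + 1) → ℝ}
    {k : ℕ} (hc : ∀ i : Fin (m + 1), (i : ℕ) < k → controlMap a r m c i = 0) (hk : k ≤ m + 1)
    {p : ℝ[X]} (hp : p ∈ degreeLT ℝ k) : eulerEval r m a c p = 0 := by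
  refine map_eq_zero_of_mem_degreeLT (e := fun i => padeDen a r i (m - i))
    (fun i => degree_padeDen ha hr i _) (fun i hi => ?_) hp
  rw [← hc ⟨i, by omega⟩ hi, controlMap_apply_eq_eulerEval_padeDen ha hr]

theorem eulerEval_right_eq_zero (ha : a ∈ Ioo 0 1) (hr : IsExponentSeq r) {c : Fin (m + 1) → ℝ}
    {k : ℕ} (hc : ∀ i : Fin (m + 1), k < (i : ℕ) → controlMap a r m c i = 0)
    {p : ℝ[X]} (hp : p ∈ degreeLT ℝ (m - k)) : eulerEval r m 1 c p = 0 := by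
  refine map_eq_zero_of_mem_degreeLT (e := fun i => padeNum a r (m - i) i)
    (fun i => degree_padeNum ha hr _ i) (fun i hi => ?_) hp
  rw [← hc ⟨m - i, by omega⟩ (show k < m - i by omega), controlMap_apply]
  simp only [show m - (m - i) = i by omega]

theorem controlMap_injective (ha : a ∈ Ioo 0 1) (hr : IsExponentSeq r) :
    Function.Injective (controlMap a r m) :=
  (injective_iff_map_eq_zero _).2 fun c hc =>
    eq_zero_of_eulerEval_eq_zero hr.strictMono.injective ha.1 fun _ hp =>
      eulerEval_left_eq_zero ha hr (fun i _ => by rw [hc, Pi.zero_apply]) le_rfl hp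

/-- The coefficient vectors `b k` are dual to the control points; these are the coefficients of the
Chebyshev–Bernstein basis. -/
def IsControlDual (a : ℝ) (r : ℕ → ℝ) (m : ℕ) (b : Fin (m + 1) → Fin (m + 1) → ℝ) : Prop :=
  ∀ k, controlMap a r m (b k) = Pi.single k 1

theorem exists_isControlDual (ha : a ∈ Ioo 0 1) (hr : IsExponentSeq r) (m : ℕ) :
    ∃ b, IsControlDual a r m b :=
  Classical.axiom_of_choice fun k =>
    LinearMap.injective_iff_surjective.1 (controlMap_injective ha hr) (Pi.single k 1)

namespace IsControlDual

variable {b : Fin (m + 1) → Fin (m + 1) → ℝ} (hb : IsControlDual a r m b)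
include hb

theorem controlMap_sum_smul (u : Fin (m + 1) → ℝ) : controlMap a r m (∑ k, u k • b k) = u := by
  rw [map_sum]
  ext i
  simp [hb _, Pi.single_apply]

theorem sum_controlMap_smul (ha : a ∈ Ioo 0 1) (hr : IsExponentSeq r) (c : Fin (m + 1) → ℝ) :
    ∑ k, controlMap a r m c k • b k = c :=
  controlMap_injective ha hr (hb.controlMap_sum_smul _)

theorem eq_zero_of_sum_mul_eqOn_zero (ha : a ∈ Ioo 0 1) (hr : IsExponentSeq r)
    {g : Fin (m + 1) → ℝ} (h : ∀ t ∈ Icc a 1, ∑ k, g k * muntzSum r m (b k) t = 0) : g = 0 := by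
  have hc : ∑ k, g k • b k = 0 :=
    eq_zero_of_muntzSum_eqOn_zero hr.strictMono.injective ha.1.le ha.2 fun t ht => by
      simpa using h t ht
  rw [← hb.controlMap_sum_smul g, hc, map_zero]

theorem linearIndependent_muntzSum (ha : a ∈ Ioo 0 1) (hr : IsExponentSeq r) :
    LinearIndependent ℝ fun k => muntzSum r m (b k) :=
  Fintype.linearIndependent_iff.2 fun _ hg => congrFun <|
    hb.eq_zero_of_sum_mul_eqOn_zero ha hr fun t _ => by simpa using congrFun hg t

theorem span_range_muntzSum (ha : a ∈ Ioo 0 1) (hr : IsExponentSeq r) :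
    Submodule.span ℝ (range fun k => muntzSum r m (b k)) = muntzSpace r m := by
  have hspan : Submodule.span ℝ (range b) = ⊤ := by
    refine eq_top_iff.2 fun c _ => ?_
    rw [← hb.sum_controlMap_smul ha hr c]
    exact Submodule.sum_mem _ fun k _ =>
      Submodule.smul_mem _ _ (Submodule.subset_span (mem_range_self k))
  rw [← range_muntzSum, ← Submodule.map_top, ← hspan, Submodule.map_span, ← range_comp]
  rfl

theorem sum_eq_single (ha : a ∈ Ioo 0 1) (hr : IsExponentSeq r) : ∑ k, b k = Pi.single 0 1 := by
  simpa [controlMap_single_zero ha hr] using hb.sum_controlMap_smul ha hr (Pi.single 0 1)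

theorem eulerEval_left_eq_zero (ha : a ∈ Ioo 0 1) (hr : IsExponentSeq r) (k : Fin (m + 1))
    {p : ℝ[X]} (hp : p ∈ degreeLT ℝ k) : eulerEval r m a (b k) p = 0 :=
  _root_.eulerEval_left_eq_zero ha hr
    (fun i hi => by rw [hb k, Pi.single_eq_of_ne (Fin.ne_of_lt hi)]) k.2.le hp

theorem eulerEval_right_eq_zero (ha : a ∈ Ioo 0 1) (hr : IsExponentSeq r) (k : Fin (m + 1))
    {p : ℝ[X]} (hp : p ∈ degreeLT ℝ (m - k)) : eulerEval r m 1 (b k) p = 0 :=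
  _root_.eulerEval_right_eq_zero ha hr
    (fun i hi => by rw [hb k, Pi.single_eq_of_ne (Fin.ne_of_gt hi)]) hp

theorem isChebyshevBernsteinBasis (ha : a ∈ Ioo 0 1) (hr : IsExponentSeq r) :
    IsChebyshevBernsteinBasis r m a 1 fun k => muntzSum r m (b k) where
  linearIndependent := hb.linearIndependent_muntzSum ha hr
  span_eq := hb.span_range_muntzSum ha hr
  sum_eq_one t _ := by
    rw [← Finset.sum_apply, ← map_sum, hb.sum_eq_single ha hr, muntzSum_single_zero hr.zero,
      Pi.one_apply]
  zeros_left k := (vanishesToOrder_muntzSum_iff ha.1).2 fun _ => hb.eulerEval_left_eq_zero ha hr k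
  zeros_right k := (vanishesToOrder_muntzSum_iff one_pos).2 fun _ =>
    hb.eulerEval_right_eq_zero ha hr k

theorem sum_muntzSum_mul_padeNum_eval (ha : a ∈ Ioo 0 1) (hr : IsExponentSeq r) {j : ℕ}
    (hj : j ≤ m) (t : ℝ) :
    ∑ k : Fin (m + 1), muntzSum r m (b k) t * (padeNum a r k (m - k)).eval (r j) = t ^ r j := by
  let j' : Fin (m + 1) := ⟨j, Nat.lt_succ_of_le hj⟩
  have h := congrFun (congrArg (muntzSum r m) (hb.sum_controlMap_smul ha hr (Pi.single j' 1))) t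
  rw [muntzSum_single] at h
  simpa [controlMap_single, mul_comm] using h

theorem eulerEval_right_eq_coeff_div (ha : a ∈ Ioo 0 1) (hr : IsExponentSeq r) (k : Fin (m + 1))
    {q : ℝ[X]} (hq : q ∈ degreeLT ℝ (m - k + 1)) :
    eulerEval r m 1 (b k) q = q.coeff (m - k) / (padeNum a r k (m - k)).coeff (m - k) := by
  have hlead := right_ne_zero_of_mul (padeNum_coeff_sign ha hr k (m - k)).ne'
  set Q := padeNum a r k (m - k) with hQ
  set s := q.coeff (m - k) / Q.coeff (m - k)
  have hlow : q - s • Q ∈ degreeLT ℝ (m - k) :=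
    mem_degreeLT_of_coeff_eq_zero (sub_mem hq (Submodule.smul_mem _ s
      (padeNum_mem_degreeLT ha hr k (m - k))))
      (by rw [coeff_sub, coeff_smul, smul_eq_mul, div_mul_cancel₀ _ hlead, sub_self])
  have hzero := hb.eulerEval_right_eq_zero ha hr k hlow
  rw [map_sub, map_smul, hQ, ← controlMap_apply, hb k, Pi.single_eq_same, smul_eq_mul, mul_one,
    sub_eq_zero] at hzero
  exact hzero

-- Interpolating `z ↦ x ^ z` at the exponents by `a ^ z * p z + q z` expresses point evaluation at
-- `x` through derivatives at `a` and `1`, of which only the highest one at `1` survives.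
theorem muntzSum_pos (ha : a ∈ Ioo 0 1) (hr : IsExponentSeq r) (k : Fin (m + 1)) {x : ℝ}
    (hx : x ∈ Ioo a 1) : 0 < muntzSum r m (b k) x := by
  obtain ⟨p, hp, q, hq, hpq⟩ := exists_rpow_mul_eval_add_eval_eq ha hr.strictMono.injective k
    (m - k + 1) fun j => x ^ r j
  have hsplit : muntzSum r m (b k) x = eulerEval r m a (b k) p + eulerEval r m 1 (b k) q := by
    simp_rw [muntzSum_apply, eulerEval_apply, ← Finset.sum_add_distrib, ← mul_add, Real.one_rpow,
      one_mul]
    exact Finset.sum_congr rfl fun j _ => by rw [hpq j (by omega)]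
  rw [hsplit, hb.eulerEval_left_eq_zero ha hr k hp, zero_add,
    hb.eulerEval_right_eq_coeff_div ha hr k hq,
    ← mul_div_mul_left _ _ (pow_ne_zero (m - k) (neg_ne_zero.2 (one_ne_zero (α := ℝ))))]
  exact div_pos
    (coeff_sign_of_interpolates_rpow ha.1 hx hr.strictMono.injective hp hq hpq)
    (padeNum_coeff_sign ha hr k (m - k))

end IsControlDual

namespace IsChebyshevBernsteinBasis

variable {B : Fin (m + 1) → ℝ → ℝ} (hB : IsChebyshevBernsteinBasis r m a 1 B)
include hB

theorem controlMap_eq_zero (ha : a ∈ Ioo 0 1) (hr : IsExponentSeq r) {c : Fin (m + 1) → ℝ}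
    {i k : Fin (m + 1)} (hc : muntzSum r m c = B k) (hik : i ≠ k) : controlMap a r m c i = 0 := by
  rcases hik.lt_or_gt with hlt | hgt
  · rw [controlMap_apply_eq_eulerEval_padeDen ha hr]
    exact (vanishesToOrder_muntzSum_iff ha.1).1 (hc ▸ hB.zeros_left k) _
      (degreeLT_mono (Nat.succ_le_of_lt hlt) (padeDen_mem_degreeLT ha hr _ _))
  · rw [controlMap_apply]
    exact (vanishesToOrder_muntzSum_iff one_pos).1 (hc ▸ hB.zeros_right k) _
      (degreeLT_mono (by omega) (padeNum_mem_degreeLT ha hr _ _))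

theorem exists_isControlDual (ha : a ∈ Ioo 0 1) (hr : IsExponentSeq r) :
    ∃ b, IsControlDual a r m b ∧ ∀ k, muntzSum r m (b k) = B k := by
  have hmem : ∀ k, B k ∈ LinearMap.range (muntzSum r m) := fun k => by
    rw [range_muntzSum, ← hB.span_eq]
    exact Submodule.subset_span (mem_range_self k)
  choose b hb using hmem
  have hsum : ∑ k, b k = Pi.single 0 1 := by
    refine sub_eq_zero.1 (eq_zero_of_muntzSum_eqOn_zero hr.strictMono.injective ha.1.le ha.2
      fun t ht => ?_)
    simp [hb, muntzSum_single_zero hr.zero, hB.sum_eq_one t ht]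
  refine ⟨b, fun k => funext fun i => ?_, hb⟩
  rcases eq_or_ne i k with rfl | hik
  · have hone := congrFun (controlMap_single_zero (m := m) ha hr) i
    rw [← hsum, map_sum, Finset.sum_apply, Finset.sum_eq_single i
      (fun k _ hk => hB.controlMap_eq_zero ha hr (hb k) hk.symm) (by simp)] at hone
    rwa [Pi.single_eq_same]
  · rw [hB.controlMap_eq_zero ha hr (hb k) hik, Pi.single_eq_of_ne hik]

theorem eq_zero_of_sum_mul_eqOn_zero (ha : a ∈ Ioo 0 1) (hr : IsExponentSeq r)
    {g : Fin (m + 1) → ℝ} (h : ∀ t ∈ Icc a 1, ∑ k, g k * B k t = 0) : g = 0 := by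
  obtain ⟨b, hb, hbB⟩ := hB.exists_isControlDual ha hr
  exact hb.eq_zero_of_sum_mul_eqOn_zero ha hr (by simpa only [hbB] using h)

theorem sum_mul_padeNum_eval (ha : a ∈ Ioo 0 1) (hr : IsExponentSeq r) {j : ℕ} (hj : j ≤ m)
    (t : ℝ) : ∑ k, B k t * (padeNum a r k (m - k)).eval (r j) = t ^ r j := by
  obtain ⟨b, hb, hbB⟩ := hB.exists_isControlDual ha hr
  simpa only [hbB] using hb.sum_muntzSum_mul_padeNum_eval ha hr hj t

theorem nonneg (ha : a ∈ Ioo 0 1) (hr : IsExponentSeq r) (k : Fin (m + 1)) {t : ℝ}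
    (ht : t ∈ Icc a 1) : 0 ≤ B k t := by
  obtain ⟨b, hb, hbB⟩ := hB.exists_isControlDual ha hr
  have hcont : ContinuousAt (B k) t := by
    rw [← hbB k, funext (muntzSum_apply (b k))]
    exact tendsto_finsetSum _ fun j _ => tendsto_const_nhds.mul
      (Real.continuousAt_rpow_const t _ (Or.inl (ha.1.trans_le ht.1).ne'))
  rw [← closure_Ioo ha.2.ne] at ht
  refine ContinuousWithinAt.closure_le ht continuousWithinAt_const hcont.continuousWithinAt
    fun x hx => ?_
  rw [← hbB k]
  exact (hb.muntzSum_pos ha hr k hx).le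

end IsChebyshevBernsteinBasis

end BernsteinBasis

section ControlPoints

variable {a : ℝ} {r : ℕ → ℝ} {m : ℕ} {V : Type*} [AddCommGroup V] [Module ℝ V]

namespace IsChebyshevBernsteinBasis

variable {B : Fin (m + 1) → ℝ → ℝ} (hB : IsChebyshevBernsteinBasis r m a 1 B)
include hB

theorem eq_of_sum_smul_eqOn (ha : a ∈ Ioo 0 1) (hr : IsExponentSeq r) {p q : Fin (m + 1) → V}
    (h : ∀ t ∈ Icc a 1, ∑ k, B k t • p k = ∑ k, B k t • q k) : p = q := by
  ext k
  refine sub_eq_zero.1 ((Module.forall_dual_apply_eq_zero_iff ℝ _).1 fun φ => ?_)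
  refine congrFun (hB.eq_zero_of_sum_mul_eqOn_zero ha hr (g := fun k => φ (p k - q k))
    fun t ht => ?_) k
  have hφ := congrArg φ (h t ht)
  simp only [map_sum, map_smul, smul_eq_mul] at hφ
  simp only [map_sub, sub_mul, Finset.sum_sub_distrib, mul_comm (φ _), hφ, sub_self]

theorem sum_smul_sum_padeNum_eval (ha : a ∈ Ioo 0 1) (hr : IsExponentSeq r) {T : Finset ℕ}
    (hT : ∀ j ∈ T, j ≤ m) (v : ℕ → V) (t : ℝ) :
    ∑ k, B k t • ∑ j ∈ T, (padeNum a r k (m - k)).eval (r j) • v j = ∑ j ∈ T, t ^ r j • v j := by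
  simp_rw [Finset.smul_sum, smul_smul]
  rw [Finset.sum_comm]
  exact Finset.sum_congr rfl fun j hj => by
    rw [← Finset.sum_smul, hB.sum_mul_padeNum_eval ha hr (hT j hj)]

end IsChebyshevBernsteinBasis

theorem isControlPolygon_iff (ha : a ∈ Ioo 0 1) (hr : IsExponentSeq r) {T : Finset ℕ}
    (hT : ∀ j ∈ T, j ≤ m) {P : ℝ → V} {v : ℕ → V}
    (hP : ∀ t ∈ Icc a 1, P t = ∑ j ∈ T, t ^ r j • v j) {p : Fin (m + 1) → V} :
    IsControlPolygon r m a 1 P p ↔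
      p = fun k : Fin (m + 1) => ∑ j ∈ T, (padeNum a r k (m - k)).eval (r j) • v j := by
  constructor
  · rintro ⟨B, hB, h⟩
    refine hB.eq_of_sum_smul_eqOn ha hr fun t ht => ?_
    rw [← h t ht, hP t ht, hB.sum_smul_sum_padeNum_eval ha hr hT]
  · rintro rfl
    obtain ⟨b, hb⟩ := exists_isControlDual ha hr m
    have hB := hb.isChebyshevBernsteinBasis ha hr
    exact ⟨_, hB, fun t ht => by rw [hP t ht, hB.sum_smul_sum_padeNum_eval ha hr hT]⟩

theorem existsUnique_isControlPolygon (ha : a ∈ Ioo 0 1) (hr : IsExponentSeq r) {T : Finset ℕ}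
    (hT : ∀ j ∈ T, j ≤ m) {P : ℝ → V} {v : ℕ → V}
    (hP : ∀ t ∈ Icc a 1, P t = ∑ j ∈ T, t ^ r j • v j) :
    ∃! p, IsControlPolygon r m a 1 P p := by
  simp only [isControlPolygon_iff ha hr hT hP, existsUnique_eq]

theorem isControlPolygon_controlPoint {b : ℝ} {P : ℝ → V}
    (h : ∃ p, IsControlPolygon r m a b P p) :
    IsControlPolygon r m a b P (controlPoint r m a b P) := by
  rw [controlPoint, dif_pos h]
  exact h.choose_spec

theorem controlPoint_eq_sum_padeNum_eval (ha : a ∈ Ioo 0 1) (hr : IsExponentSeq r) {T : Finset ℕ}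
    (hT : ∀ j ∈ T, j ≤ m) {P : ℝ → V} {v : ℕ → V}
    (hP : ∀ t ∈ Icc a 1, P t = ∑ j ∈ T, t ^ r j • v j) (i : Fin (m + 1)) :
    controlPoint r m a 1 P i = ∑ j ∈ T, (padeNum a r i (m - i)).eval (r j) • v j :=
  congrFun ((isControlPolygon_iff ha hr hT hP).1 (isControlPolygon_controlPoint
    (existsUnique_isControlPolygon ha hr hT hP).exists)) i

theorem controlPoint_rpow (ha : a ∈ Ioo 0 1) (hr : IsExponentSeq r) {j : ℕ} (hj : j ≤ m)
    (i : Fin (m + 1)) :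
    controlPoint r m a 1 (fun t => t ^ r j) i = (padeNum a r i (m - i)).eval (r j) := by
  rw [controlPoint_eq_sum_padeNum_eval ha hr (T := {j}) (v := 1) (by simpa using hj)
    (by simp)]
  simp

theorem existsUnique_isControlPolygon_rpow (ha : a ∈ Ioo 0 1) (hr : IsExponentSeq r) {j : ℕ}
    (hj : j ≤ m) : ∃! q, IsControlPolygon r m a 1 (fun t => t ^ r j) q :=
  existsUnique_isControlPolygon ha hr (T := {j}) (v := 1) (by simpa using hj) (by simp)

end ControlPoints

section Concentration

variable {a : ℝ} {r : ℕ → ℝ}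

namespace IsChebyshevBernsteinBasis

variable {m : ℕ} {B : Fin (m + 1) → ℝ → ℝ} (hB : IsChebyshevBernsteinBasis r m a 1 B)
include hB

theorem sum_mul_sub_rpow_sq (ha : a ∈ Ioo 0 1) (hr : IsExponentSeq r) {j : ℕ} (hj : j ≤ m) {t : ℝ}
    (ht : t ∈ Icc a 1) :
    ∑ k, B k t * ((padeNum a r k (m - k)).eval (r j) - t ^ r j) ^ 2 =
      ∑ k, B k t * (padeNum a r k (m - k)).eval (r j) ^ 2 - (t ^ r j) ^ 2 := by
  have hexpand : ∀ k, B k t * ((padeNum a r k (m - k)).eval (r j) - t ^ r j) ^ 2 =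
      B k t * (padeNum a r k (m - k)).eval (r j) ^ 2 -
        2 * t ^ r j * (B k t * (padeNum a r k (m - k)).eval (r j)) + (t ^ r j) ^ 2 * B k t :=
    fun k => by ring
  simp only [hexpand, Finset.sum_add_distrib, Finset.sum_sub_distrib, ← Finset.mul_sum,
    hB.sum_eq_one t ht, hB.sum_mul_padeNum_eval ha hr hj]
  ring

theorem sum_mul_sq_le (ha : a ∈ Ioo 0 1) (hr : IsExponentSeq r) {T : Finset ℕ}
    (hT : ∀ j ∈ T, j ≤ m) {d : ℕ → ℝ} {ε : ℝ}
    (h : ∀ i ≤ m, (padeNum a r i (m - i)).eval (r 1) ^ 2 ≤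
      ∑ j ∈ T, d j * (padeNum a r i (m - i)).eval (r j) + ε) {t : ℝ} (ht : t ∈ Icc a 1) :
    ∑ k, B k t * (padeNum a r k (m - k)).eval (r 1) ^ 2 ≤ ∑ j ∈ T, d j * t ^ r j + ε := by
  calc ∑ k, B k t * (padeNum a r k (m - k)).eval (r 1) ^ 2
      ≤ ∑ k, B k t * (∑ j ∈ T, d j * (padeNum a r k (m - k)).eval (r j) + ε) :=
        Finset.sum_le_sum fun k _ =>
          mul_le_mul_of_nonneg_left (h k (Nat.le_of_lt_succ k.2)) (hB.nonneg ha hr k ht)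
    _ = ∑ j ∈ T, d j * t ^ r j + ε := by
        have hsum := hB.sum_smul_sum_padeNum_eval ha hr hT d t
        simp only [smul_eq_mul, mul_comm _ (d _)] at hsum
        simp only [mul_add, Finset.sum_add_distrib, hsum, ← Finset.sum_mul, hB.sum_eq_one t ht,
          one_mul]

theorem rpow_sub_padeNum_eval_sq_le (ha : a ∈ Ioo 0 1) (hr : IsExponentSeq r) {i j : ℕ}
    (hi : i ≤ m) (hj : j ≤ m) {t : ℝ} (ht : t ∈ Icc a 1)
    (hti : (padeNum a r i (m - i)).eval (r 1) = t ^ r 1) :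
    (t ^ r j - (padeNum a r i (m - i)).eval (r j)) ^ 2 ≤ (r j / r 1) ^ 2 *
      ∑ k, B k t * ((padeNum a r k (m - k)).eval (r 1) - t ^ r 1) ^ 2 := by
  set u := (padeNum a r i (m - i)).eval (r j)
  have hmean : t ^ r j - u = ∑ k, B k t * ((padeNum a r k (m - k)).eval (r j) - u) := by
    simp only [mul_sub, Finset.sum_sub_distrib, hB.sum_mul_padeNum_eval ha hr hj,
      ← Finset.sum_mul, hB.sum_eq_one t ht, one_mul]
  calc (t ^ r j - u) ^ 2
      ≤ ∑ k, B k t * ((padeNum a r k (m - k)).eval (r j) - u) ^ 2 := by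
        rw [hmean]
        exact Real.pow_arith_mean_le_arith_mean_pow_of_even _ _ _
          (fun k _ => hB.nonneg ha hr k ht) (hB.sum_eq_one t ht) even_two
    _ ≤ ∑ k, B k t * (r j / r 1 * ((padeNum a r k (m - k)).eval (r 1) - t ^ r 1)) ^ 2 := by
        refine Finset.sum_le_sum fun k _ =>
          mul_le_mul_of_nonneg_left (sq_le_sq.2 ?_) (hB.nonneg ha hr k ht)
        rw [abs_mul, abs_of_nonneg (div_nonneg (hr.nonneg j) (hr.nonneg 1)), ← hti]
        exact abs_padeNum_eval_sub_le ha hr (Nat.le_of_lt_succ k.2) hi hj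
    _ = _ := by
        rw [Finset.mul_sum]
        exact Finset.sum_congr rfl fun k _ => by ring

end IsChebyshevBernsteinBasis

theorem eventually_sum_mul_sub_rpow_sq_le (ha : a ∈ Ioo 0 1) (hr : IsExponentSeq r)
    (hlim : Tendsto r atTop atTop)
    (hMuntz : Tendsto (fun N : ℕ => ∑ i ∈ Finset.Icc 1 N, 1 / r i) atTop atTop)
    {ε : ℝ} (hε : 0 < ε) :
    ∀ᶠ m in atTop, ∀ B, IsChebyshevBernsteinBasis r m a 1 B → ∀ t ∈ Icc a 1,
      ∑ k, B k t * ((padeNum a r k (m - k)).eval (r 1) - t ^ r 1) ^ 2 ≤ ε := by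
  obtain ⟨n, d, hd⟩ := exists_abs_rpow_sub_sum_le_of_muntz hr hlim hMuntz
    (mul_pos two_pos (hr.pos one_pos)) (ε := ε / 3) (by positivity)
  have hsq : ∀ x ∈ Icc (0 : ℝ) 1, |(x ^ r 1) ^ 2 - ∑ j ∈ Finset.Ioc 0 n, d j * x ^ r j| ≤ ε / 3 :=
    fun x hx => by simpa only [mul_comm 2 (r 1), Real.rpow_mul hx.1, Real.rpow_two] using hd x hx
  have hpade := eventually_padeNum_sq_le ha hr hlim hMuntz (n := n) (d := d)
    (show ε / 3 < 2 * ε / 3 by linarith) fun x hx => by linarith [(abs_le.1 (hsq x hx)).2]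
  filter_upwards [hpade, eventually_ge_atTop 1, eventually_ge_atTop n] with m hm h1m hnm B hB t ht
  rw [hB.sum_mul_sub_rpow_sq ha hr h1m ht]
  linarith [(abs_le.1 (hsq t ⟨ha.1.le.trans ht.1, ht.2⟩)).1,
    hB.sum_mul_sq_le ha hr (fun j hj => (Finset.mem_Ioc.1 hj).2.trans hnm) hm ht]

theorem rpow_one_div_mem_Icc (ha : 0 ≤ a) {u z : ℝ} (hz : 0 < z) (hu : u ∈ Icc (a ^ z) 1) :
    u ^ (1 / z) ∈ Icc a 1 := by
  have hu0 : 0 ≤ u := (Real.rpow_nonneg ha _).trans hu.1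
  refine ⟨?_, Real.rpow_le_one hu0 hu.2 (one_div_nonneg.2 hz.le)⟩
  rw [one_div]
  exact (Real.le_rpow_inv_iff_of_pos ha hu0 hz).2 hu.1

theorem tendsto_padeNum_rpow_sub (ha : a ∈ Ioo 0 1) (hr : IsExponentSeq r)
    (hlim : Tendsto r atTop atTop)
    (hMuntz : Tendsto (fun N : ℕ => ∑ i ∈ Finset.Icc 1 N, 1 / r i) atTop atTop) (j : ℕ) :
    Tendsto (fun p : ℕ × ℕ => ((padeNum a r p.1 (p.2 - p.1)).eval (r 1) ^ (1 / r 1)) ^ r j -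
      (padeNum a r p.1 (p.2 - p.1)).eval (r j)) triangleAtTop (𝓝 0) := by
  rw [Metric.tendsto_nhds]
  intro ε hε
  rw [eventually_triangleAtTop]
  set C := r j / r 1
  obtain ⟨δ, hδ, hCδ⟩ : ∃ δ > 0, C ^ 2 * δ < ε ^ 2 := by
    refine ⟨ε ^ 2 / (C ^ 2 + 1), by positivity, ?_⟩
    rw [mul_div_assoc', div_lt_iff₀ (by positivity), mul_comm, mul_add_one]
    exact lt_add_of_pos_right _ (pow_pos hε 2)
  filter_upwards [eventually_sum_mul_sub_rpow_sq_le ha hr hlim hMuntz hδ, eventually_ge_atTop 1,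
    eventually_ge_atTop j] with m hvar h1m hjm i hi
  have hu := padeNum_eval_mem_Icc ha m hr i (m - i) (by omega) 1 h1m
  set t := (padeNum a r i (m - i)).eval (r 1) ^ (1 / r 1) with ht_def
  have ht : t ∈ Icc a 1 := rpow_one_div_mem_Icc ha.1.le (hr.pos one_pos) hu
  have hti : (padeNum a r i (m - i)).eval (r 1) = t ^ r 1 := by
    rw [ht_def, one_div, Real.rpow_inv_rpow ((Real.rpow_nonneg ha.1.le _).trans hu.1)
      (hr.pos one_pos).ne']
  obtain ⟨b, hb⟩ := exists_isControlDual ha hr m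
  have hB := hb.isChebyshevBernsteinBasis ha hr
  rw [dist_zero_right, Real.norm_eq_abs]
  refine abs_lt_of_sq_lt_sq ?_ hε.le
  exact (hB.rpow_sub_padeNum_eval_sq_le ha hr hi hjm ht hti).trans_lt
    ((mul_le_mul_of_nonneg_left (hvar _ hB t ht) (sq_nonneg C)).trans_lt hCδ)

end Concentration

theorem tendsto_iSup_norm_of_tendsto_triangleAtTop {V : Type*} [SeminormedAddCommGroup V]
    {f : ℕ × ℕ → V} (hf : Tendsto f triangleAtTop (𝓝 0)) :
    Tendsto (fun m => ⨆ i : Fin (m + 1), ‖f (i, m)‖) atTop (𝓝 0) := by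
  rw [Metric.tendsto_nhds]
  intro ε hε
  have hev := eventually_triangleAtTop.1 (Metric.tendsto_nhds.1 hf (ε / 2) (half_pos hε))
  filter_upwards [hev] with m hm
  rw [dist_zero_right, Real.norm_of_nonneg (Real.iSup_nonneg fun _ => norm_nonneg _)]
  refine (ciSup_le fun i => ?_).trans_lt (half_lt_self hε)
  simpa only [dist_zero_right] using (hm i (Nat.le_of_lt_succ i.2)).le

theorem exists_eq_sum_of_mem_muntzSpace {ι : Type*} {r : ℕ → ℝ} {n : ℕ} {P : ℝ → ι → ℝ}
    (hP : ∀ c, (fun t => P t c) ∈ muntzSpace r n) :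
    ∃ v : ℕ → ι → ℝ, ∀ t, P t = ∑ j ∈ Finset.range (n + 1), t ^ r j • v j := by
  simp only [← range_muntzSum, LinearMap.mem_range] at hP
  choose d hd using hP
  refine ⟨fun j c => if h : j < n + 1 then d c ⟨j, h⟩ else 0, fun t => funext fun c => ?_⟩
  rw [← congrFun (hd c) t, muntzSum_apply, Finset.sum_apply, Finset.sum_range]
  exact Finset.sum_congr rfl fun j _ => by simp [j.2, mul_comm]

theorem corollary1_general {V : Type*} [NormedAddCommGroup V] [NormedSpace ℝ V] (r : ℕ → ℝ)
    (hr0 : r 0 = 0) (hr : StrictMono r) (hlim : Tendsto r atTop atTop)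
    (hMuntz : Tendsto (fun N : ℕ => ∑ i ∈ Finset.Icc 1 N, 1 / r i) atTop atTop)
    (a : ℝ) (ha0 : 0 < a) (ha1 : a < 1) (n : ℕ) (P : ℝ → V) (v : ℕ → V)
    (hP : ∀ t ∈ Icc a 1, P t = ∑ j ∈ Finset.range (n + 1), t ^ r j • v j) :
    (∀ m, n ≤ m → ∃! p : Fin (m + 1) → V, IsControlPolygon r m a 1 P p) ∧
    (∀ m, 1 ≤ m → ∃! q : Fin (m + 1) → ℝ, IsControlPolygon r m a 1 (fun t => t ^ r 1) q) ∧
    (∀ m, 1 ≤ m → ∀ i, controlPoint r m a 1 (fun t => t ^ r 1) i ∈ Icc (a ^ r 1) 1) ∧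
    Tendsto (fun m : ℕ => ⨆ i : Fin (m + 1),
        ‖P ((controlPoint r m a 1 (fun t => t ^ r 1) i) ^ (1 / r 1)) -
          controlPoint r m a 1 P i‖) atTop (𝓝 0) := by
  have ha : a ∈ Ioo 0 1 := ⟨ha0, ha1⟩
  have hρ : IsExponentSeq r := ⟨hr0, hr⟩
  have hn : ∀ {m}, n ≤ m → ∀ j ∈ Finset.range (n + 1), j ≤ m := fun hm j hj =>
    (Nat.le_of_lt_succ (Finset.mem_range.1 hj)).trans hm
  have hmem : ∀ m, 1 ≤ m → ∀ i, controlPoint r m a 1 (fun t => t ^ r 1) i ∈ Icc (a ^ r 1) 1 := by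
    intro m hm i
    rw [controlPoint_rpow ha hρ hm]
    exact padeNum_eval_mem_Icc ha m hρ i (m - i) (by omega) 1 hm
  refine ⟨fun m hm => existsUnique_isControlPolygon ha hρ (hn hm) hP,
    fun m hm => existsUnique_isControlPolygon_rpow ha hρ hm, hmem, ?_⟩
  have hsum := tendsto_finsetSum (Finset.range (n + 1)) fun j _ =>
    (tendsto_padeNum_rpow_sub ha hρ hlim hMuntz j).smul_const (v j)
  simp only [zero_smul, Finset.sum_const_zero] at hsum
  refine (tendsto_iSup_norm_of_tendsto_triangleAtTop hsum).congr' ?_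
  filter_upwards [eventually_ge_atTop n, eventually_ge_atTop 1] with m hnm h1m
  refine iSup_congr fun i => ?_
  rw [hP _ (rpow_one_div_mem_Icc ha0.le (hρ.pos one_pos) (hmem m h1m i)),
    controlPoint_eq_sum_padeNum_eval ha hρ (hn hnm) hP, controlPoint_rpow ha hρ h1m]
  simp only [sub_smul, Finset.sum_sub_distrib]

theorem corollary1 (r : ℕ → ℝ) (hr0 : r 0 = 0) (hr : StrictMono r)
    (hlim : Tendsto r atTop atTop)
    (hMuntz : Tendsto (fun N : ℕ => ∑ i ∈ Finset.Icc 1 N, 1 / r i) atTop atTop)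
    (a : ℝ) (ha0 : 0 < a) (ha1 : a < 1) (s n : ℕ)
    (P : ℝ → Fin s → ℝ) (hP : ∀ c : Fin s, (fun t => P t c) ∈ muntzSpace r n) :
    -- the control points of `P` and of `t ^ r 1` are well defined, and those of `t ^ r 1`
    -- have their `1 / r 1`-th powers in `[a, 1]`
    (∀ m, n ≤ m → ∃! p : Fin (m + 1) → Fin s → ℝ, IsControlPolygon r m a 1 P p) ∧
    (∀ m, 1 ≤ m → ∃! q : Fin (m + 1) → ℝ, IsControlPolygon r m a 1 (fun t => t ^ r 1) q) ∧
    (∀ m, 1 ≤ m → ∀ i, controlPoint r m a 1 (fun t => t ^ r 1) i ∈ Set.Icc (a ^ r 1) 1) ∧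
    -- the convergence, in the sup norm of `ℝ ^ s` and uniformly in `i`
    Tendsto (fun m : ℕ => ⨆ i : Fin (m + 1),
        ‖P ((controlPoint r m a 1 (fun t => t ^ r 1) i) ^ (1 / r 1)) -
          controlPoint r m a 1 P i‖) atTop (𝓝 0) :=
  let ⟨v, hv⟩ := exists_eq_sum_of_mem_muntzSpace hP
  corollary1_general r hr0 hr hlim hMuntz a ha0 ha1 n P v fun t _ => hv t
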